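/- Conventions. A $\mathbb Z$-lattice $L$ is a discrete subgroup spanning a finite-dimensional Euclidean space $(E,\langle\cdot,\cdot\rangle)$, with dual $L^\#=\{x\in E : \langle x,y\rangle\in\mathbb Z \text{ for all } y\in L\}$. It is $3$-modular if it is even (that is, $\langle x,x\rangle\in 2\mathbb Z$ for all $x\in L$) and there is a similarity $\sigma$ of $E$ with $\langle\sigma x,\sigma y\rangle=3\langle x,y\rangle$ for all $x,y\in E$ and $\sigma(L^\#)=L$. The norm of $x\in L$ is $\tfrac12\langle x,x\rangle$, and the minimum of $L$ is the smallest norm of a nonzero vector of $L$. Let $\omega=\frac{-1+\sqrt{-3}}2$. An Eisenstein lattice is a finitely generated $\mathbb Z[\omega]$-submodule $L$ of a vector space $V$ over $\mathbb Q(\sqrt{-3})$ with a positive definite hermitian product $(\cdot,\cdot)$ such that $L$ contains a basis of $V$ and $(x,y)\in\mathbb Z[\omega]$ for all $x,y\in L$. It is unimodular if the Gram matrix of a basis of $L$ has determinant $1$, and indecomposable if it is nonzero and is not the orthogonal sum of two nonzero sublattices. The norm of $x\in L$ is $(x,x)$. Proposition. Every $3$-modular $\mathbb Z$-lattice of rank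 $28$ with minimum at least $2$ has exactly $17472=2^6\cdot 3\cdot 7\cdot 13$ vectors of norm $3$. In particular, every indecomposable unimodular Eisenstein lattice of rank $14$ has exactly $17472$ vectors of norm $3$. -/

import Mathlib

/-!
# Modular ℤ-lattices and Hermitian lattices over the Eisenstein integers

A ℤ-lattice is a discrete subgroup `L` spanning a Euclidean space `E` (Mathlib's `IsZLattice`).
The norm of a lattice vector `x` is half of its inner square; this is the normalisation in which
an even lattice has integral norms, in which the theta series is `∑ q ^ norm x`, and in which the
norm of a Hermitian lattice over the Eisenstein integers agrees with the norm of the underlying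
even ℤ-lattice (with the trace form `2 Re (x, y)`).
-/

section ZLattices

variable {E : Type*} [NormedAddCommGroup E] [InnerProductSpace ℝ E]

/-- The dual lattice `L^# = {x ∈ E | ⟪x, y⟫ ∈ ℤ for all y ∈ L}`. -/
noncomputable def zDual (L : Submodule ℤ E) : Submodule ℤ E :=
  LinearMap.BilinForm.dualSubmodule (innerₗ E) L

/-- `L` is even: every inner square is an even integer. (By polarisation `L` is then integral.) -/
def IsEvenLattice (L : Submodule ℤ E) : Prop :=
  ∀ x ∈ L, ∃ n : ℤ, inner ℝ x x = 2 * (n : ℝ)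

/-- `L` is `ℓ`-modular: it is even, and some similarity `σ` of the ambient Euclidean space that
multiplies the inner product by `ℓ` maps the dual lattice onto `L`; in other words
`L ≅ √ℓ L^#`. -/
def IsModularZLattice (ℓ : ℕ) (L : Submodule ℤ E) : Prop :=
  IsEvenLattice L ∧
    ∃ σ : E ≃ₗ[ℝ] E, (∀ x y : E, inner ℝ (σ x) (σ y) = (ℓ : ℝ) * inner ℝ x y) ∧
      σ '' (zDual L : Set E) = (L : Set E)

/-- The norm `⟪x, x⟫ / 2` of a vector of an even lattice. -/
noncomputable def evenNorm (x : E) : ℝ := inner ℝ x x / 2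

end ZLattices

section EisensteinLattices

/-- `-3` is not a square in `ℚ`; this makes `QuadraticAlgebra ℚ (-3) 0` a field. -/
instance factNegThreeNotSquare : Fact (∀ r : ℚ, r ^ 2 ≠ (-3 : ℚ) + 0 * r) :=
  ⟨fun r h => by nlinarith [sq_nonneg r]⟩

/-- The field `ℚ(√-3)`; the element `⟨a, b⟩` is `a + b √-3`, and `star` is the nontrivial
automorphism (complex conjugation) `a + b √-3 ↦ a - b √-3`. -/
abbrev QSqrtNegThree : Type := QuadraticAlgebra ℚ (-3) 0

/-- The primitive third root of unity `ω = (-1 + √-3) / 2`. -/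
def eisOmega : QSqrtNegThree := ⟨-1 / 2, 1 / 2⟩

/-- The ring `ℤ[ω]` of Eisenstein integers. -/
abbrev EisensteinInt : Subalgebra ℤ QSqrtNegThree := Algebra.adjoin ℤ {eisOmega}

variable {V : Type*} [AddCommGroup V] [Module QSqrtNegThree V]

/-- The sesquilinear form `h` (linear in the first, conjugate linear in the second variable) is a
positive definite Hermitian product. By symmetry each `h x x` is rational, so it is equal to its
component `(h x x).re`. -/
structure IsHermitianProduct (h : V →ₗ[QSqrtNegThree] V →ₗ⋆[QSqrtNegThree] QSqrtNegThree) :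
    Prop where
  conj_symm : ∀ x y : V, star (h x y) = h y x
  pos : ∀ x : V, x ≠ 0 → 0 < (h x x).re

/-- `L` is an (integral) Hermitian lattice in `(V, h)`: a finitely generated `ℤ[ω]`-submodule that
contains a basis of `V` and on which `h` takes values in `ℤ[ω]`. -/
structure IsEisensteinLattice
    (h : V →ₗ[QSqrtNegThree] V →ₗ⋆[QSqrtNegThree] QSqrtNegThree)
    (L : Submodule EisensteinInt V) : Prop where
  fg : L.FG
  span_eq_top : Submodule.span QSqrtNegThree (L : Set V) = ⊤
  integral : ∀ x ∈ L, ∀ y ∈ L, h x y ∈ EisensteinInt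

/-- `L` is unimodular: the Gram matrix of a basis of `L` has determinant `1`. (Another basis
multiplies the determinant by `u * star u = 1` with a unit `u`, so the choice is irrelevant.) -/
def IsUnimodularEisenstein
    (h : V →ₗ[QSqrtNegThree] V →ₗ⋆[QSqrtNegThree] QSqrtNegThree)
    (L : Submodule EisensteinInt V) : Prop :=
  ∃ (n : ℕ) (b : Module.Basis (Fin n) EisensteinInt L),
    Matrix.det (Matrix.of fun i j : Fin n => h (b i : V) (b j : V)) = 1

/-- `L` is (orthogonally) indecomposable: it is nonzero, and whenever it is the sum of two mutually
orthogonal sublattices, one of them is zero. -/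
def IsIndecomposableEisenstein
    (h : V →ₗ[QSqrtNegThree] V →ₗ⋆[QSqrtNegThree] QSqrtNegThree)
    (L : Submodule EisensteinInt V) : Prop :=
  L ≠ ⊥ ∧ ∀ M N : Submodule EisensteinInt V, M ⊔ N = L →
    (∀ x ∈ M, ∀ y ∈ N, h x y = 0) → M = ⊥ ∨ N = ⊥

end EisensteinLattices

/-!
The theta series `θ = ∑ q ^ (⟪x, x⟫ / 2)` of a `3`-modular lattice of rank `28` behaves like a
modular form of weight `14` for the group generated by `τ ↦ τ + 1` and the Fricke involution
`τ ↦ -1 / (3 τ)`: the lattice is even, so `θ` is a power series in `q`, and Poisson summation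
together with `L ≅ √3 L^#` gives `θ(-1 / (3 τ)) = -3 ^ 7 τ ^ 14 θ(τ)` (`latticeTheta_fricke`). The
covolume need not be computed: the Fricke involution has order two, which fixes the constant up to
sign.

Forms with this behaviour are determined by their coefficients of `1`, `q`, `q ^ 2`. Indeed, if `f`
vanishes to order three at infinity, then `f ^ 4 / (Δ(τ) Δ(3τ)) ^ 3` is holomorphic in `q`, because
`Δ` has no zeros on the upper half plane and a simple zero at infinity. Its weight is `-16`, so its
modulus is at most `C * Im τ ^ 8`, and it vanishes by the maximum principle (`eq_zero_of_fricke`).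
The boundedness needs no exact fundamental domain: translations and the Fricke involution move
every point to `Im τ ≥ 1/4` (`le_of_fricke_invariant`). Three explicit forms built from
`E₄` and `E₆` at `τ` and `3τ` span the space, and it turns out that the coefficient of `q ^ 3` is
a combination of those of `1` and `q` alone: it is `17472` for the coefficients `1`, `0`
(`coeff_three_of_fricke`).

A unimodular Eisenstein lattice of rank `14`, with the trace form `2 Re (x, y)`, is a `3`-modular
`ℤ`-lattice of rank `28`; the similarity is multiplication by `√-3`, since the trace dual of `ℤ[ω]`
is `(1 / √-3) ℤ[ω]` (`exists_trace_lattice`). To have it in a Euclidean space, the Gram matrix is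
shown to be positive definite over `ℂ` by density of `ℚ(√-3)` in `ℂ` and factored as `Bᴴ * B`. A
vector of norm one would split off an orthogonal summand, so indecomposability gives minimum at
least two.
-/

/-! ### The Fricke involution of level three -/

/-- Multiplication by `3` on the upper half plane. -/
noncomputable def mulThree (τ : UpperHalfPlane) : UpperHalfPlane :=
  (⟨3, by norm_num⟩ : {x : ℝ // 0 < x}) • τ

@[simp] lemma coe_mulThree (τ : UpperHalfPlane) : ((mulThree τ : UpperHalfPlane) : ℂ) = 3 * τ := by
  simp [mulThree]

/-- The Fricke involution `τ ↦ -1 / (3 τ)` of level `3`. -/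
noncomputable def fricke (τ : UpperHalfPlane) : UpperHalfPlane := ModularGroup.S • mulThree τ

lemma coe_fricke (τ : UpperHalfPlane) : ((fricke τ : UpperHalfPlane) : ℂ) = -1 / (3 * τ) := by
  rw [fricke, UpperHalfPlane.modular_S_smul]
  simp [neg_div]

lemma mulThree_fricke (τ : UpperHalfPlane) : mulThree (fricke τ) = ModularGroup.S • τ := by
  ext1
  have := τ.ne_zero
  rw [coe_mulThree, coe_fricke, UpperHalfPlane.modular_S_smul]
  simp only
  field_simp

lemma fricke_fricke (τ : UpperHalfPlane) : fricke (fricke τ) = τ := by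
  ext1
  have := τ.ne_zero
  rw [coe_fricke, coe_fricke]
  field_simp

lemma im_fricke (τ : UpperHalfPlane) : (fricke τ).im = τ.im / (3 * ‖(τ : ℂ)‖ ^ 2) := by
  have h : (fricke τ).im = ((fricke τ : UpperHalfPlane) : ℂ).im := rfl
  have h2 := τ.normSq_pos
  rw [h, coe_fricke, Complex.div_im, ← Complex.normSq_eq_norm_sq]
  simp [Complex.normSq_mul, Complex.normSq_ofNat]
  field_simp

/-- Weight `k` invariance under `S`, written without the slash action. -/
lemma slash_S_eq {k : ℕ} {f : UpperHalfPlane → ℂ}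
    (hf : SlashAction.map (k : ℤ) ModularGroup.S f = f) (τ : UpperHalfPlane) :
    f (ModularGroup.S • τ) = (τ : ℂ) ^ k * f τ := by
  have h := congrFun hf τ
  rw [ModularForm.SL_slash_apply, ModularGroup.denom_S] at h
  rw [← h]
  have := τ.ne_zero
  simp only [zpow_neg, zpow_natCast]
  field_simp

lemma modularForm_S {k : ℕ}
    (f : ModularForm (Matrix.SpecialLinearGroup.mapGL (n := Fin 2) (R := ℤ) ℝ).range k)
    (τ : UpperHalfPlane) : f (ModularGroup.S • τ) = (τ : ℂ) ^ k * f τ :=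
  slash_S_eq (k := k) (SlashInvariantFormClass.slash_action_eq f
    (Matrix.SpecialLinearGroup.mapGL ℝ ModularGroup.S) ⟨_, rfl⟩) τ

lemma discriminant_S (τ : UpperHalfPlane) :
    ModularForm.discriminant (ModularGroup.S • τ) = (τ : ℂ) ^ 12 * ModularForm.discriminant τ :=
  slash_S_eq (k := 12) ModularForm.discriminant_S_invariant τ

/-- A function on the upper half plane invariant under translations and the Fricke involution
and bounded above on `Im τ ≥ 1/4` is bounded above. -/
lemma le_of_fricke_invariant {u : UpperHalfPlane → ℝ} {C : ℝ}
    (hT : ∀ (n : ℤ) τ, u ((n : ℝ) +ᵥ τ) = u τ) (hW : ∀ τ, u (fricke τ) = u τ)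
    (hC : ∀ τ : UpperHalfPlane, 1 / 4 ≤ τ.im → u τ ≤ C) (τ : UpperHalfPlane) : u τ ≤ C := by
  -- If `|Re τ| ≤ 1/2` and `Im τ < 1/4`, the involution increases `Im` by a factor `≥ 16/15`.
  have key : ∀ (m : ℕ) (τ : UpperHalfPlane), 1 / 4 ≤ (16 / 15 : ℝ) ^ m * τ.im → u τ ≤ C := by
    intro m
    induction m with
    | zero => intro τ h; exact hC τ (by simpa using h)
    | succ m ih =>
      intro τ h
      by_cases h4 : 1 / 4 ≤ τ.im
      · exact hC τ h4
      push Not at h4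
      set σ : UpperHalfPlane := ((-round τ.re : ℤ) : ℝ) +ᵥ τ with hσ
      have hσim : σ.im = τ.im := by simp [hσ]
      have hσre : |σ.re| ≤ 1 / 2 := by
        have := abs_sub_round τ.re
        simpa [hσ, neg_add_eq_sub] using this
      have hn : ‖(σ : ℂ)‖ ^ 2 ≤ 5 / 16 := by
        rw [← Complex.normSq_eq_norm_sq, Complex.normSq_apply]
        have h1 : (σ : ℂ).re = σ.re := rfl
        have h2 : (σ : ℂ).im = σ.im := rfl
        have := σ.im_pos
        rw [h1, h2]
        have := sq_le_sq' (abs_le.mp hσre).1 (abs_le.mp hσre).2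
        nlinarith
      rw [← hT (-round τ.re) τ, ← hσ, ← hW]
      apply ih
      rw [im_fricke, hσim]
      refine h.trans ?_
      rw [pow_succ, mul_assoc]
      gcongr
      have hpos : 0 < ‖(σ : ℂ)‖ := norm_pos_iff.mpr σ.ne_zero
      rw [le_div_iff₀ (by positivity)]
      have := τ.im_pos
      nlinarith
  obtain ⟨m, hm⟩ := pow_unbounded_of_one_lt (1 / 4 / τ.im) (by norm_num : (1 : ℝ) < 16 / 15)
  exact key m τ ((div_le_iff₀ τ.im_pos).mp hm.le)

/-! ### Beginnings of `q`-expansions -/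

/-- `f` agrees, up to a holomorphic multiple of `q ^ 4`, with the cubic polynomial in `q` with
coefficients `c₀, c₁, c₂, c₃`; here `q = exp (2 π i τ)`. -/
def HasJet (f : UpperHalfPlane → ℂ) (c₀ c₁ c₂ c₃ : ℂ) : Prop :=
  ∃ G : ℂ → ℂ, DifferentiableOn ℂ G (Metric.ball 0 1) ∧ ∀ τ : UpperHalfPlane,
    f τ = c₀ + c₁ * Function.Periodic.qParam 1 τ + c₂ * Function.Periodic.qParam 1 τ ^ 2
      + c₃ * Function.Periodic.qParam 1 τ ^ 3
      + Function.Periodic.qParam 1 τ ^ 4 * G (Function.Periodic.qParam 1 τ)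

lemma qParam_mem_ball (τ : UpperHalfPlane) :
    Function.Periodic.qParam 1 τ ∈ Metric.ball (0 : ℂ) 1 := by
  simpa using Function.Periodic.norm_qParam_lt_one one_pos τ.im_pos

lemma exists_qParam_eq {q : ℂ} (hq : ‖q‖ < 1) (h0 : q ≠ 0) :
    ∃ τ : UpperHalfPlane, Function.Periodic.qParam 1 τ = q :=
  ⟨⟨_, Function.Periodic.im_invQParam_pos_of_norm_lt_one one_pos hq h0⟩,
    Function.Periodic.qParam_right_inv one_ne_zero h0⟩

lemma qParam_mulThree (τ : UpperHalfPlane) :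
    Function.Periodic.qParam 1 (mulThree τ) = Function.Periodic.qParam 1 τ ^ 3 := by
  rw [coe_mulThree, Function.Periodic.qParam, Function.Periodic.qParam, ← Complex.exp_nat_mul]
  congr 1
  push_cast
  ring

lemma pow_three_mem_ball {q : ℂ} (hq : q ∈ Metric.ball (0 : ℂ) 1) :
    q ^ 3 ∈ Metric.ball (0 : ℂ) 1 := by
  simp only [mem_ball_zero_iff, norm_pow] at hq ⊢
  exact pow_lt_one₀ (norm_nonneg _) hq (by norm_num)

namespace HasJet

variable {f g : UpperHalfPlane → ℂ} {a₀ a₁ a₂ a₃ b₀ b₁ b₂ b₃ : ℂ}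

lemma mul (hf : HasJet f a₀ a₁ a₂ a₃) (hg : HasJet g b₀ b₁ b₂ b₃) :
    HasJet (fun τ => f τ * g τ) (a₀ * b₀) (a₀ * b₁ + a₁ * b₀) (a₀ * b₂ + a₁ * b₁ + a₂ * b₀)
      (a₀ * b₃ + a₁ * b₂ + a₂ * b₁ + a₃ * b₀) := by
  obtain ⟨F, hF, hf⟩ := hf
  obtain ⟨G, hG, hg⟩ := hg
  refine ⟨fun q => (a₀ + a₁ * q + a₂ * q ^ 2 + a₃ * q ^ 3) * G q
    + F q * (b₀ + b₁ * q + b₂ * q ^ 2 + b₃ * q ^ 3) + q ^ 4 * F q * G q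
    + (a₁ * b₃ + a₂ * b₂ + a₃ * b₁) + (a₂ * b₃ + a₃ * b₂) * q + a₃ * b₃ * q ^ 2, ?_, ?_⟩
  · fun_prop
  · intro τ
    simp only [hf, hg]
    ring

lemma add (hf : HasJet f a₀ a₁ a₂ a₃) (hg : HasJet g b₀ b₁ b₂ b₃) :
    HasJet (fun τ => f τ + g τ) (a₀ + b₀) (a₁ + b₁) (a₂ + b₂) (a₃ + b₃) := by
  obtain ⟨F, hF, hf⟩ := hf
  obtain ⟨G, hG, hg⟩ := hg
  refine ⟨fun q => F q + G q, by fun_prop, fun τ => ?_⟩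
  simp only [hf, hg]
  ring

lemma const_mul (c : ℂ) (hf : HasJet f a₀ a₁ a₂ a₃) :
    HasJet (fun τ => c * f τ) (c * a₀) (c * a₁) (c * a₂) (c * a₃) := by
  obtain ⟨F, hF, hf⟩ := hf
  refine ⟨fun q => c * F q, by fun_prop, fun τ => ?_⟩
  simp only [hf]
  ring

lemma comp_mulThree (hf : HasJet f a₀ a₁ a₂ a₃) :
    HasJet (fun τ => f (mulThree τ)) a₀ 0 0 a₁ := by
  obtain ⟨F, hF, hf⟩ := hf
  refine ⟨fun q => a₂ * q ^ 2 + a₃ * q ^ 5 + q ^ 8 * F (q ^ 3), ?_, fun τ => ?_⟩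
  · have : DifferentiableOn ℂ (fun q => F (q ^ 3)) (Metric.ball 0 1) :=
      hF.comp (by fun_prop) fun q hq => pow_three_mem_ball hq
    exact DifferentiableOn.add (by fun_prop) (DifferentiableOn.mul (by fun_prop) this)
  · simp only [hf, qParam_mulThree]
    ring

end HasJet

lemma hasJet_of_hasSum {f : UpperHalfPlane → ℂ} {a : ℕ → ℂ}
    (h : ∀ τ : UpperHalfPlane, HasSum (fun n => a n * Function.Periodic.qParam 1 τ ^ n) (f τ)) :
    HasJet f (a 0) (a 1) (a 2) (a 3) := by
  refine ⟨fun q => ∑' n, a (n + 4) * q ^ n, ?_, fun τ => ?_⟩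
  · intro q hq
    obtain ⟨r, hqr, hr⟩ := exists_between (mem_ball_zero_iff.mp hq)
    have hr0 : 0 < r := (norm_nonneg _).trans_lt hqr
    have hrc : (r : ℂ) ≠ 0 := by exact_mod_cast hr0.ne'
    obtain ⟨τ, hτ⟩ := exists_qParam_eq (q := (r : ℂ)) (by simpa [abs_of_pos hr0] using hr) hrc
    have hs : Summable fun n => ‖a (n + 4)‖ * r ^ n := by
      have h1 := ((summable_nat_add_iff 4).mpr (h τ).summable.norm).mul_right ((r ^ 4)⁻¹)
      refine h1.congr fun n => ?_
      rw [hτ, norm_mul, norm_pow, Complex.norm_real, Real.norm_of_nonneg hr0.le, pow_add]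
      field_simp
    have hd : DifferentiableOn ℂ (fun q => ∑' n, a (n + 4) * q ^ n) (Metric.ball 0 r) := by
      refine Complex.differentiableOn_tsum_of_summable_norm hs (fun n => by fun_prop)
        Metric.isOpen_ball fun n w hw => ?_
      rw [norm_mul, norm_pow]
      gcongr
      exact (mem_ball_zero_iff.mp hw).le
    exact ((hd q (by simpa using hqr)).differentiableAt
      (Metric.isOpen_ball.mem_nhds (by simpa using hqr))).differentiableWithinAt
  · have hs := (h τ).summable
    rw [← (h τ).tsum_eq, ← hs.sum_add_tsum_nat_add 4, ← tsum_mul_left]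
    simp only [Finset.sum_range_succ, Finset.sum_range_zero, pow_zero, pow_one, pow_add]
    congr 1
    · ring
    · exact tsum_congr fun n => by ring

lemma hasJet_E₄ : HasJet ModularForm.E₄ 1 240 2160 6720 := by
  have h := hasJet_of_hasSum fun τ =>
    ModularForm.hasSum_qExpansion (f := ModularForm.E₄) one_pos one_mem_strictPeriods_SL τ
  have hb : bernoulli 4 = -1 / 30 := by decide +kernel
  have h2 : ArithmeticFunction.sigma 3 2 = 9 := by decide +kernel
  have h3 : ArithmeticFunction.sigma 3 3 = 28 := by decide +kernel
  rw [ModularForm.E₄] at h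
  simp only [EisensteinSeries.E_qExpansion_coeff _ ⟨2, rfl⟩, hb, h2, h3] at h
  norm_num [h2, h3] at h
  exact h

lemma hasJet_E₆ : HasJet ModularForm.E₆ 1 (-504) (-16632) (-122976) := by
  have h := hasJet_of_hasSum fun τ =>
    ModularForm.hasSum_qExpansion (f := ModularForm.E₆) one_pos one_mem_strictPeriods_SL τ
  have hb : bernoulli 6 = 1 / 42 := by decide +kernel
  have h2 : ArithmeticFunction.sigma 5 2 = 33 := by decide +kernel
  have h3 : ArithmeticFunction.sigma 5 3 = 244 := by decide +kernel
  rw [ModularForm.E₆] at h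
  simp only [EisensteinSeries.E_qExpansion_coeff _ ⟨3, rfl⟩, hb, h2, h3] at h
  norm_num [h2, h3] at h
  exact h

/-! ### A Sturm bound for the Fricke group -/

/-- `Δ = q P(q)` with `P` holomorphic and without zeros on the unit disc. -/
lemma exists_discriminant_eq_qParam_mul : ∃ P : ℂ → ℂ, DifferentiableOn ℂ P (Metric.ball 0 1) ∧
    (∀ q ∈ Metric.ball (0 : ℂ) 1, P q ≠ 0) ∧ ∀ τ : UpperHalfPlane,
      ModularForm.discriminant τ =
        Function.Periodic.qParam 1 τ * P (Function.Periodic.qParam 1 τ) := by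
  set D := UpperHalfPlane.cuspFunction 1 ModularForm.discriminant with hD
  have hmem : Metric.ball (0 : ℂ) 1 ∈ nhds 0 := Metric.ball_mem_nhds 0 one_pos
  have hDd : DifferentiableOn ℂ D (Metric.ball 0 1) := fun q hq =>
    (ModularFormClass.differentiableAt_cuspFunction CuspForm.discriminant one_pos
      one_mem_strictPeriods_SL (mem_ball_zero_iff.mp hq)).differentiableWithinAt
  have hD0 : D 0 = 0 := by
    rw [hD, ModularForm.discriminant_cuspFunction_eqOn (Metric.mem_ball_self one_pos)]
    exact zero_mul _
  have hD1 : deriv D 0 = 1 := by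
    simpa [UpperHalfPlane.qExpansion_coeff] using ModularForm.discriminant_qExpansion_coeff_one
  have hτ : ∀ τ : UpperHalfPlane, ModularForm.discriminant τ =
      Function.Periodic.qParam 1 τ * dslope D 0 (Function.Periodic.qParam 1 τ) := fun τ => by
    have h1 := SlashInvariantFormClass.eq_cuspFunction CuspForm.discriminant τ
      one_mem_strictPeriods_SL one_ne_zero
    have h2 := sub_smul_dslope D 0 (Function.Periodic.qParam 1 τ)
    rw [hD0, sub_zero, sub_zero, smul_eq_mul] at h2
    rw [h2]
    exact h1.symm
  refine ⟨dslope D 0, (Complex.differentiableOn_dslope hmem).mpr hDd, fun q hq => ?_, hτ⟩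
  rcases eq_or_ne q 0 with rfl | h0
  · simp [hD1]
  · obtain ⟨τ, rfl⟩ := exists_qParam_eq (mem_ball_zero_iff.mp hq) h0
    intro h
    have := hτ τ
    rw [h, mul_zero] at this
    exact ModularForm.discriminant_ne_zero τ this

lemma qParam_int_vadd (n : ℤ) (τ : UpperHalfPlane) :
    Function.Periodic.qParam 1 (((n : ℝ) +ᵥ τ : UpperHalfPlane) : ℂ) =
      Function.Periodic.qParam 1 τ := by
  have h := Complex.exp_periodic.int_mul n (2 * Real.pi * Complex.I * τ)
  simp only [Function.Periodic.qParam, UpperHalfPlane.coe_vadd, Complex.ofReal_one, div_one]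
  rw [← h]
  congr 1
  push_cast
  ring

/-- If the modulus of a holomorphic function of `q` is bounded by `C * Im τ ^ 8`, then it tends to
zero at the boundary of the unit disc, so the function vanishes by the maximum principle. -/
lemma eq_zero_of_norm_le_im_pow {H : ℂ → ℂ} (hH : DifferentiableOn ℂ H (Metric.ball 0 1)) {C : ℝ}
    (hC : ∀ τ : UpperHalfPlane, ‖H (Function.Periodic.qParam 1 τ)‖ ≤ C * τ.im ^ 8) : H 0 = 0 := by
  have key : ∀ y : ℝ, 0 < y → ‖H 0‖ ≤ C * y ^ 8 := by
    intro y hy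
    set r : ℝ := Real.exp (-2 * Real.pi * y) with hr
    have hr0 : 0 < r := Real.exp_pos _
    have hr1 : r < 1 := by
      rw [hr, Real.exp_lt_one_iff]
      have := Real.pi_pos
      nlinarith [mul_pos this hy]
    refine Complex.norm_le_of_forall_mem_frontier_norm_le (U := Metric.ball 0 r)
      Metric.isBounded_ball ?_ (fun z hz => ?_) (subset_closure (Metric.mem_ball_self hr0))
    · refine (hH.mono ?_).diffContOnCl
      exact Metric.closure_ball_subset_closedBall.trans (Metric.closedBall_subset_ball hr1)
    · rw [frontier_ball 0 hr0.ne', mem_sphere_zero_iff_norm] at hz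
      obtain ⟨τ, rfl⟩ := exists_qParam_eq (hz ▸ hr1) (norm_pos_iff.mp (hz ▸ hr0))
      have h1 : τ.im = y := by
        rw [Function.Periodic.norm_qParam, hr, Real.exp_eq_exp] at hz
        have := Real.pi_pos
        have h2 : (2 * Real.pi) * (τ : ℂ).im = (2 * Real.pi) * y := by linarith
        exact mul_left_cancel₀ (by positivity) h2
      rw [← h1]
      exact hC τ
  have h0 : ‖H 0‖ ≤ 0 := by
    refine ge_of_tendsto (f := fun y : ℝ => C * y ^ 8) (x := nhdsWithin (0 : ℝ) (Set.Ioi 0)) ?_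
      (Filter.eventually_of_mem self_mem_nhdsWithin fun y hy => key y hy)
    have : Filter.Tendsto (fun y : ℝ => C * y ^ 8) (nhds 0) (nhds (C * 0 ^ 8)) :=
      (by fun_prop : Continuous fun y : ℝ => C * y ^ 8).tendsto 0
    simpa using this.mono_left nhdsWithin_le_nhds
  exact norm_le_zero_iff.mp h0

/-- Sturm bound in weight `14` for the group generated by `τ ↦ τ + 1` and the Fricke involution:
a form that vanishes to order `3` at infinity vanishes to higher order. Only the absolute values of
the values of `f` enter, so its multiplier is irrelevant. -/
theorem eq_zero_of_fricke {f : UpperHalfPlane → ℂ} {G : ℂ → ℂ}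
    (hG : DifferentiableOn ℂ G (Metric.ball 0 1))
    (hf : ∀ τ : UpperHalfPlane,
      f τ = Function.Periodic.qParam 1 τ ^ 3 * G (Function.Periodic.qParam 1 τ))
    (hW : ∀ τ : UpperHalfPlane, ‖f (fricke τ)‖ = 3 ^ 7 * ‖(τ : ℂ)‖ ^ 14 * ‖f τ‖) : G 0 = 0 := by
  obtain ⟨P, hP, hP0, hΔ⟩ := exists_discriminant_eq_qParam_mul
  -- The quotient of `f ^ 4` by the twelfth order form `(Δ(τ) Δ(3τ)) ^ 3`, as a function of `q`.
  set H : ℂ → ℂ := fun q => G q ^ 4 / (P q * P (q ^ 3)) ^ 3 with hH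
  have hHd : DifferentiableOn ℂ H (Metric.ball 0 1) := by
    have h1 : DifferentiableOn ℂ (fun q => P (q ^ 3)) (Metric.ball 0 1) :=
      hP.comp (by fun_prop) fun q hq => pow_three_mem_ball hq
    exact (hG.pow 4).div ((hP.mul h1).pow 3) fun q hq =>
      pow_ne_zero _ (mul_ne_zero (hP0 q hq) (hP0 _ (pow_three_mem_ball hq)))
  have hHf : ∀ τ : UpperHalfPlane, H (Function.Periodic.qParam 1 τ) =
      f τ ^ 4 / (ModularForm.discriminant τ * ModularForm.discriminant (mulThree τ)) ^ 3 := by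
    intro τ
    have h0 : Function.Periodic.qParam 1 (τ : ℂ) ≠ 0 := Complex.exp_ne_zero _
    have h1 := hP0 _ (qParam_mem_ball τ)
    have h2 := hP0 _ (pow_three_mem_ball (qParam_mem_ball τ))
    rw [hH, hf, hΔ, hΔ, qParam_mulThree]
    field_simp
  -- The weight of `H` is `4 * 14 - 3 * 24 = -16`, so `‖H‖ * Im ^ (-8)` is invariant.
  set u : UpperHalfPlane → ℝ := fun τ => ‖H (Function.Periodic.qParam 1 τ)‖ / τ.im ^ 8 with hu
  obtain ⟨C, hC⟩ : ∃ C, ∀ τ : UpperHalfPlane, 1 / 4 ≤ τ.im → u τ ≤ C := by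
    set r : ℝ := Real.exp (-2 * Real.pi * (1 / 4)) with hr
    have hr1 : r < 1 := by
      rw [hr, Real.exp_lt_one_iff]
      have := Real.pi_pos
      linarith
    obtain ⟨C, hC⟩ := (isCompact_closedBall (0 : ℂ) r).exists_bound_of_continuousOn
      (hHd.continuousOn.mono (Metric.closedBall_subset_ball hr1))
    refine ⟨C / (1 / 4) ^ 8, fun τ hτ => ?_⟩
    have hb : ‖H (Function.Periodic.qParam 1 τ)‖ ≤ C := by
      apply hC
      rw [mem_closedBall_zero_iff, Function.Periodic.norm_qParam, hr, Real.exp_le_exp]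
      have h1 : 1 / 4 ≤ (τ : ℂ).im := hτ
      have := Real.pi_pos
      nlinarith
    have := (norm_nonneg _).trans hb
    exact div_le_div₀ this hb (by norm_num) (pow_le_pow_left₀ (by norm_num) hτ 8)
  have hT : ∀ (n : ℤ) τ, u ((n : ℝ) +ᵥ τ) = u τ := fun n τ => by
    simp only [hu, qParam_int_vadd, UpperHalfPlane.vadd_im]
  have hWu : ∀ τ, u (fricke τ) = u τ := fun τ => by
    have hτ := norm_pos_iff.mpr τ.ne_zero
    have hi := τ.im_pos
    have hd1 := norm_pos_iff.mpr (ModularForm.discriminant_ne_zero τ)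
    have hd2 := norm_pos_iff.mpr (ModularForm.discriminant_ne_zero (mulThree τ))
    simp only [hu, hHf, norm_div, norm_pow, norm_mul, hW, im_fricke, mulThree_fricke,
      discriminant_S]
    rw [fricke, discriminant_S, norm_mul, norm_pow, coe_mulThree, norm_mul]
    norm_num
    field_simp
    ring
  have hu_le := le_of_fricke_invariant hT hWu hC
  have hH0 : H 0 = 0 := eq_zero_of_norm_le_im_pow hHd (C := C) fun τ =>
    (div_le_iff₀ (pow_pos τ.im_pos 8)).mp (hu_le τ)
  have hP00 := hP0 0 (Metric.mem_ball_self one_pos)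
  simpa [hH, hP00] using hH0

/-! ### The coefficient of `q ^ 3` in weight fourteen -/

/-- For level one forms `F`, `G` of weights `a` and `b = 14 - a`, the Fricke involution exchanges
`F(τ) G(3τ)` and `F(3τ) G(τ)` up to powers of `3`, so that a suitable combination of the two is an
eigenfunction with the eigenvalue of the theta series. -/
lemma fricke_antisymmetrization {F G : UpperHalfPlane → ℂ} {a b : ℕ} (hab : a + b = 14)
    (hF : ∀ τ : UpperHalfPlane, F (ModularGroup.S • τ) = (τ : ℂ) ^ a * F τ)
    (hG : ∀ τ : UpperHalfPlane, G (ModularGroup.S • τ) = (τ : ℂ) ^ b * G τ) (τ : UpperHalfPlane) :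
    3 ^ 7 * (F (fricke τ) * G (mulThree (fricke τ)))
        + -3 ^ a * (F (mulThree (fricke τ)) * G (fricke τ)) =
      -3 ^ 7 * (τ : ℂ) ^ 14 * (3 ^ 7 * (F τ * G (mulThree τ))
        + -3 ^ a * (F (mulThree τ) * G τ)) := by
  have h3 : (3 : ℂ) ^ a * 3 ^ b = 3 ^ 7 * 3 ^ 7 := by rw [← pow_add, hab]; norm_num
  have ht : (τ : ℂ) ^ a * τ ^ b = τ ^ 14 := by rw [← pow_add, hab]
  rw [mulThree_fricke, hF, hG, fricke, hF, hG, coe_mulThree, mul_pow, mul_pow]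
  linear_combination
    (3 ^ 7 * 3 ^ a * F (mulThree τ) * G τ - F τ * G (mulThree τ) * 3 ^ a * 3 ^ b) * ht
    - F τ * G (mulThree τ) * τ ^ 14 * h3

lemma E₄_S (τ : UpperHalfPlane) :
    ModularForm.E₄ (ModularGroup.S • τ) = (τ : ℂ) ^ 4 * ModularForm.E₄ τ := modularForm_S _ τ

lemma E₆_S (τ : UpperHalfPlane) :
    ModularForm.E₆ (ModularGroup.S • τ) = (τ : ℂ) ^ 6 * ModularForm.E₆ τ := modularForm_S _ τ

/-- The eigenfunction made from level one forms `F` and `G`, with the beginning of its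
`q`-expansion. -/
lemma exists_fricke_form {F G : UpperHalfPlane → ℂ} {a b : ℕ} (hab : a + b = 14)
    (hF : ∀ τ : UpperHalfPlane, F (ModularGroup.S • τ) = (τ : ℂ) ^ a * F τ)
    (hG : ∀ τ : UpperHalfPlane, G (ModularGroup.S • τ) = (τ : ℂ) ^ b * G τ)
    {f₀ f₁ f₂ f₃ g₀ g₁ g₂ g₃ : ℂ} (hFj : HasJet F f₀ f₁ f₂ f₃) (hGj : HasJet G g₀ g₁ g₂ g₃) :
    ∃ f : UpperHalfPlane → ℂ, (∀ τ : UpperHalfPlane, f (fricke τ) = -3 ^ 7 * (τ : ℂ) ^ 14 * f τ) ∧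
      HasJet f ((3 ^ 7 - 3 ^ a) * f₀ * g₀) (3 ^ 7 * f₁ * g₀ - 3 ^ a * f₀ * g₁)
        (3 ^ 7 * f₂ * g₀ - 3 ^ a * f₀ * g₂)
        (3 ^ 7 * (f₃ * g₀ + f₀ * g₁) - 3 ^ a * (f₁ * g₀ + f₀ * g₃)) := by
  refine ⟨fun τ => 3 ^ 7 * (F τ * G (mulThree τ)) + -3 ^ a * (F (mulThree τ) * G τ),
    fricke_antisymmetrization hab hF hG, ?_⟩
  convert ((hFj.mul hGj.comp_mulThree).const_mul (3 ^ 7)).add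
    ((hFj.comp_mulThree.mul hGj).const_mul (-3 ^ a)) using 1 <;> ring

/-- The space of forms of weight `14` with this Fricke eigenvalue has dimension three and contains
a form `q ^ 2 + O(q ^ 4)`. Hence the coefficient of `q ^ 3` does not depend on that of `q ^ 2`, and
it is `17472` if the constant coefficient is `1` and the coefficient of `q` is `0`. -/
theorem coeff_three_of_fricke {f : UpperHalfPlane → ℂ} {a₂ a₃ : ℂ} (hf : HasJet f 1 0 a₂ a₃)
    (hW : ∀ τ : UpperHalfPlane, f (fricke τ) = -3 ^ 7 * (τ : ℂ) ^ 14 * f τ) : a₃ = 17472 := by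
  have hone : HasJet (fun _ => 1) 1 0 0 0 := ⟨fun _ => 0, by fun_prop, fun τ => by ring⟩
  obtain ⟨A, hAW, hA⟩ := exists_fricke_form (a := 14) (b := 0) rfl
    (F := fun τ => ModularForm.E₄ τ * ModularForm.E₄ τ * ModularForm.E₆ τ)
    (fun τ => by simp only [E₄_S, E₆_S]; ring) (fun τ => by ring)
    ((hasJet_E₄.mul hasJet_E₄).mul hasJet_E₆) hone
  obtain ⟨B, hBW, hB⟩ := exists_fricke_form (a := 8) (b := 6) rfl
    (F := fun τ => ModularForm.E₄ τ * ModularForm.E₄ τ)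
    (fun τ => by simp only [E₄_S]; ring) E₆_S (hasJet_E₄.mul hasJet_E₄) hasJet_E₆
  obtain ⟨C, hCW, hC⟩ := exists_fricke_form (a := 10) (b := 4) rfl
    (F := fun τ => ModularForm.E₄ τ * ModularForm.E₆ τ)
    (fun τ => by simp only [E₄_S, E₆_S]; ring) E₄_S (hasJet_E₄.mul hasJet_E₆) hasJet_E₄
  norm_num at hA hB hC
  -- `x, y, z` solve the linear system that makes the coefficients of `1`, `q`, `q ^ 2` vanish.
  have hx : ∃ x y z : ℂ, HasJet (fun τ => f τ + x * A τ + y * B τ + z * C τ) 0 0 0 (a₃ - 17472) := by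
    refine ⟨(2663 / 5913600 + 17 / 212889600 * a₂) / 3 ^ 7,
      (869 / 537600 - 349 / 19353600 * a₂) / 3 ^ 7,
      (67 / 140800 - 3 / 563200 * a₂) / 3 ^ 7, ?_⟩
    convert ((hf.add (hA.const_mul _)).add (hB.const_mul _)).add (hC.const_mul _) using 1 <;>
      ring
  obtain ⟨x, y, z, G, hG, hG'⟩ := hx
  have h0 := eq_zero_of_fricke (G := fun q => (a₃ - 17472) + q * G q) (by fun_prop)
    (f := fun τ => f τ + x * A τ + y * B τ + z * C τ) (fun τ => (hG' τ).trans (by ring)) fun τ => by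
      have : f (fricke τ) + x * A (fricke τ) + y * B (fricke τ) + z * C (fricke τ) =
          -3 ^ 7 * (τ : ℂ) ^ 14 * (f τ + x * A τ + y * B τ + z * C τ) := by
        rw [hW, hAW, hBW, hCW]
        ring
      simp only [this, norm_mul, norm_neg, norm_pow]
      norm_num
  simpa [sub_eq_zero] using h0

/-! ### Poisson summation in several variables -/

section Poisson

open MeasureTheory

variable {ι : Type*} [Fintype ι]

lemma mFourier_coe (m : ι → ℤ) (v : ι → ℝ) :
    UnitAddTorus.mFourier m (fun i => (v i : UnitAddCircle)) =
      Complex.exp (2 * Real.pi * Complex.I * ∑ i, (m i * v i : ℝ)) := by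
  simp only [UnitAddTorus.mFourier, ContinuousMap.coe_mk, fourier_coe_apply, Complex.ofReal_one,
    div_one]
  rw [← Complex.exp_sum, Complex.ofReal_sum, Finset.mul_sum]
  congr 1
  refine Finset.sum_congr rfl fun i _ => ?_
  push_cast
  ring

lemma coe_restrictScalars_equivFun_symm {E : Type*} [AddCommGroup E] [Module ℝ E]
    (b : Module.Basis ι ℝ E) (k : ι → ℤ) :
    (((b.restrictScalars ℤ).equivFun.symm k : Submodule.span ℤ (Set.range b)) : E) =
      b.equivFun.symm fun i => (k i : ℝ) := by
  rw [Module.Basis.equivFun_symm_apply, Module.Basis.equivFun_symm_apply]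
  simp [Int.cast_smul_eq_zsmul]

/-- Integration over `ℝ ^ ι` as an integral over the unit cube of the sum over integral
translates. -/
lemma integral_eq_tsum_integral_cube {f : (ι → ℝ) → ℂ} (hf : Integrable f) :
    ∫ v, f v = ∑' k : ι → ℤ,
      ∫ v in {v : ι → ℝ | ∀ i, v i ∈ Set.Ioc (0 : ℝ) (0 + 1)}, f (v + fun i => (k i : ℝ)) := by
  set b := Pi.basisFun ℝ ι
  set e : Submodule.span ℤ (Set.range b) ≃ (ι → ℤ) := (b.restrictScalars ℤ).equivFun.toEquiv
  have : VAddInvariantMeasure (Submodule.span ℤ (Set.range b)) (ι → ℝ) volume :=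
    ⟨fun c s _ => measure_preimage_add volume (c : ι → ℝ) s⟩
  rw [(ZSpan.isAddFundamentalDomain b volume).integral_eq_tsum'' f hf, ← e.symm.tsum_eq]
  have hcube : ZSpan.fundamentalDomain b =ᵐ[volume]
      {v : ι → ℝ | ∀ i, v i ∈ Set.Ioc (0 : ℝ) (0 + 1)} := by
    have h1 : {v : ι → ℝ | ∀ i, v i ∈ Set.Ioc (0 : ℝ) (0 + 1)} =
        Set.univ.pi fun _ => Set.Ioc (0 : ℝ) 1 := by
      ext v; simp
    rw [ZSpan.fundamentalDomain_pi_basisFun, h1]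
    exact Measure.univ_pi_Ico_ae_eq_Icc.trans Measure.univ_pi_Ioc_ae_eq_Icc.symm
  refine tsum_congr fun k => ?_
  rw [setIntegral_congr_set hcube]
  have hk : ((e.symm k : Submodule.span ℤ (Set.range b)) : ι → ℝ) = fun i => (k i : ℝ) := by
    refine (coe_restrictScalars_equivFun_symm b k).trans ?_
    simp [b]
  congr 1
  ext v
  rw [Submodule.vadd_def, vadd_eq_add, hk, add_comm]

/-- Poisson summation on `ℝ ^ ι`, for continuous functions whose integral translates are summable
uniformly on bounded sets and whose Fourier coefficients are summable. -/
theorem tsum_eq_tsum_fourier_pi {g : (ι → ℝ) → ℂ} (hg : Continuous g) (hgi : Integrable g)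
    (hu : ∀ R : ℝ, ∃ u : (ι → ℤ) → ℝ, Summable u ∧
      ∀ k v, ‖v‖ ≤ R → ‖g (v + fun i => (k i : ℝ))‖ ≤ u k)
    (hF : Summable fun m : ι → ℤ =>
      ∫ v, Complex.exp (-(2 * Real.pi * Complex.I * ∑ i, (m i * v i : ℝ))) * g v) :
    ∑' k : ι → ℤ, g (fun i => (k i : ℝ)) = ∑' m : ι → ℤ,
      ∫ v, Complex.exp (-(2 * Real.pi * Complex.I * ∑ i, (m i * v i : ℝ))) * g v := by
  set S : (ι → ℝ) → ℂ := fun v => ∑' k : ι → ℤ, g (v + fun i => (k i : ℝ)) with hS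
  have hSc : Continuous S := by
    rw [continuous_iff_continuousAt]
    intro v
    obtain ⟨u, hus, hu⟩ := hu (‖v‖ + 1)
    have h1 : ContinuousOn S (Metric.closedBall 0 (‖v‖ + 1)) :=
      continuousOn_tsum (fun k => (by fun_prop : Continuous fun v => g (v + _)).continuousOn)
        hus fun k w hw => hu k w (mem_closedBall_zero_iff.mp hw)
    refine h1.continuousAt (Filter.mem_of_superset
      (Metric.isOpen_ball.mem_nhds (?_ : v ∈ Metric.ball 0 (‖v‖ + 1))) Metric.ball_subset_closedBall)
    simp
  have hSp : ∀ v w : ι → ℝ, (∀ i, (v i : UnitAddCircle) = w i) → S v = S w := by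
    intro v w h
    have h' : ∀ i, ∃ n : ℤ, w i + n = v i := by
      intro i
      obtain ⟨n, hn⟩ := (QuotientAddGroup.eq_iff_sub_mem.mp (h i))
      exact ⟨n, by simp at hn; linarith⟩
    choose n hn using h'
    simp only [hS]
    rw [← (Equiv.addLeft n).tsum_eq fun k => g (w + fun i => (k i : ℝ))]
    refine tsum_congr fun k => congrArg g ?_
    ext i
    simp [← hn i, add_assoc]
  -- The periodization descends to the torus.
  have hq : IsOpenQuotientMap (Pi.map fun (_ : ι) (x : ℝ) => (x : UnitAddCircle)) :=
    IsOpenQuotientMap.piMap fun _ => QuotientAddGroup.isOpenQuotientMap_mk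
  set F : UnitAddTorus ι → ℂ := fun t => S (Function.surjInv hq.surjective t) with hFdef
  have hFS : ∀ v : ι → ℝ, F (fun i => (v i : UnitAddCircle)) = S v := fun v =>
    hSp _ _ fun i => congrFun (Function.surjInv_eq hq.surjective fun i => (v i : UnitAddCircle)) i
  have hFc : Continuous F := by
    rw [hq.isQuotientMap.continuous_iff]
    exact hSc.congr fun v => (hFS v).symm
  set Fc : C(UnitAddTorus ι, ℂ) := ⟨F, hFc⟩
  have hcoef : ∀ m, UnitAddTorus.mFourierCoeff Fc m =
      ∫ v, Complex.exp (-(2 * Real.pi * Complex.I * ∑ i, (m i * v i : ℝ))) * g v := by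
    intro m
    set χ : (ι → ℝ) → ℂ := fun v => Complex.exp (-(2 * Real.pi * Complex.I * ∑ i, (m i * v i : ℝ)))
      with hχ
    have hχc : Continuous χ := by fun_prop
    have hχn : ∀ v, ‖χ v‖ = 1 := fun v => by
      have : χ v = Complex.exp ((-(2 * Real.pi * ∑ i, (m i * v i : ℝ)) : ℝ) * Complex.I) := by
        simp only [hχ]; congr 1; push_cast; ring
      rw [this, Complex.norm_exp_ofReal_mul_I]
    have hχp : ∀ v (k : ι → ℤ), χ (v + fun i => (k i : ℝ)) = χ v := fun v k => by
      simp only [hχ]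
      rw [Complex.exp_eq_exp_iff_exists_int]
      refine ⟨-∑ i, m i * k i, ?_⟩
      simp only [Pi.add_apply, mul_add, Finset.sum_add_distrib]
      push_cast
      ring
    have hint : Integrable fun v => χ v * g v :=
      hgi.bdd_mul (c := 1) hχc.aestronglyMeasurable (.of_forall fun v => (hχn v).le)
    rw [integral_eq_tsum_integral_cube hint, UnitAddTorus.mFourierCoeff_eq_integral _ _ 0]
    simp only [Pi.zero_apply]
    set Q := {v : ι → ℝ | ∀ i, v i ∈ Set.Ioc (0 : ℝ) (0 + 1)} with hQ
    have hQm : MeasurableSet Q := MeasurableSet.univ_pi' fun _ => measurableSet_Ioc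
    have hQn : ∀ v ∈ Q, ‖v‖ ≤ 1 := fun v hv => by
      rw [pi_norm_le_iff_of_nonneg zero_le_one]
      intro i
      have := hv i
      rw [Set.mem_Ioc] at this
      rw [Real.norm_of_nonneg this.1.le]
      linarith [this.2]
    have hQf : volume Q < ⊤ :=
      (measure_mono fun v hv => mem_closedBall_zero_iff.mpr (hQn v hv)).trans_lt
        (isCompact_closedBall (0 : ι → ℝ) 1).measure_lt_top
    obtain ⟨u, hus, hu⟩ := hu 1
    rw [integral_tsum_of_summable_integral_norm]
    · refine setIntegral_congr_fun hQm fun v _ => ?_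
      simp only [hχp, tsum_mul_left, smul_eq_mul]
      rw [mFourier_coe]
      congr 1
      · simp only [hχ]
        congr 1
        push_cast
        simp [Finset.sum_neg_distrib]
      · exact hFS v
    · intro k
      exact (hint.comp_add_right _).integrableOn
    · refine Summable.of_nonneg_of_le (fun k => integral_nonneg fun v => norm_nonneg _)
        (fun k => ?_) (hus.mul_right (volume.real Q))
      have := norm_setIntegral_le_of_norm_le_const (μ := volume) (C := u k) hQf
        (f := fun v => ‖χ (v + fun i => (k i : ℝ)) * g (v + fun i => (k i : ℝ))‖) fun v hv => by
          rw [norm_norm, norm_mul, hχn, one_mul]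
          exact hu k v (hQn v hv)
      exact (Real.le_norm_self _).trans this
  have hfin := UnitAddTorus.hasSum_mFourier_series_apply_of_summable (f := Fc)
    (by simpa only [funext hcoef] using hF) (fun i => ((0 : ι → ℝ) i : UnitAddCircle))
  simp only [mFourier_coe, hcoef] at hfin
  have h0 : Fc (fun i => ((0 : ι → ℝ) i : UnitAddCircle)) = S 0 := hFS 0
  rw [h0] at hfin
  simpa [hS] using hfin.tsum_eq.symm

end Poisson

/-! ### Theta inversion -/

section GaussianPoisson

open MeasureTheory

variable {ι : Type*} [Fintype ι] {E : Type*} [NormedAddCommGroup E] [InnerProductSpace ℝ E]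

lemma exp_neg_le_factorial_mul_inv_pow (N : ℕ) {t : ℝ} (ht : 0 < t) :
    Real.exp (-t) ≤ N.factorial * t⁻¹ ^ N := by
  have h := Real.pow_div_factorial_le_exp t ht.le N
  rw [Real.exp_neg, inv_pow, ← inv_le_inv₀ (by positivity) (by positivity), mul_inv, inv_inv,
    inv_inv]
  calc _ = t ^ N / N.factorial := by ring
    _ ≤ _ := h

lemma summable_exp_neg_mul_sq_norm [FiniteDimensional ℝ E] (L : Submodule ℤ E)
    [DiscreteTopology L] {c : ℝ} (hc : 0 < c) :
    Summable fun x : L => Real.exp (-(c * ‖(x : E)‖ ^ 2)) := by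
  set N := Module.finrank ℤ L + 1
  have h := (ZLattice.summable_norm_pow_inv L (2 * N) (by omega)).mul_left (N.factorial * c⁻¹ ^ N)
  refine Summable.of_norm_bounded_eventually h ?_
  filter_upwards [(Set.finite_singleton (0 : L)).compl_mem_cofinite] with x hx
  have hx0 : 0 < ‖(x : E)‖ := by simpa using hx
  rw [Real.norm_of_nonneg (Real.exp_pos _).le]
  refine (exp_neg_le_factorial_mul_inv_pow N (by positivity)).trans_eq ?_
  rw [pow_mul, mul_inv, mul_pow, mul_assoc, Submodule.coe_norm, inv_pow ‖(x : E)‖ 2]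

lemma summable_exp_neg_mul_sq_norm_basis [FiniteDimensional ℝ E] (b : Module.Basis ι ℝ E) {c : ℝ}
    (hc : 0 < c) : Summable fun k : ι → ℤ =>
      Real.exp (-(c * ‖b.equivFun.symm fun i => (k i : ℝ)‖ ^ 2)) := by
  have h := summable_exp_neg_mul_sq_norm (Submodule.span ℤ (Set.range b)) hc
  rw [← (b.restrictScalars ℤ).equivFun.symm.toEquiv.summable_iff] at h
  refine h.congr fun k => ?_
  rw [← coe_restrictScalars_equivFun_symm]
  rfl

lemma norm_cexp_neg_pi_mul_sq_norm {F : Type*} [NormedAddCommGroup F] (s : ℂ) (x : F) :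
    ‖Complex.exp (-(Real.pi * s * (‖x‖ : ℂ) ^ 2))‖ = Real.exp (-(Real.pi * s.re * ‖x‖ ^ 2)) := by
  rw [Complex.norm_exp]
  congr 1
  have : -(Real.pi * s * (‖x‖ : ℂ) ^ 2) = ((-(Real.pi * ‖x‖ ^ 2) : ℝ) : ℂ) * s := by
    push_cast; ring
  rw [this, Complex.re_ofReal_mul]
  ring

/-- The change of variables from coordinates in a basis to the Euclidean space. -/
lemma exists_integral_equivFun_symm [FiniteDimensional ℝ E] [MeasurableSpace E] [BorelSpace E]
    (b : Module.Basis ι ℝ E) :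
    ∃ c : ℝ, 0 < c ∧ (∀ f : E → ℂ, ∫ v, f (b.equivFun.symm v) = c * ∫ x, f x) ∧
      ∀ f : E → ℂ, Integrable f → Integrable fun v => f (b.equivFun.symm v) := by
  set φ : (ι → ℝ) ≃L[ℝ] E := b.equivFunL.symm
  set μ : Measure E := Measure.map φ volume with hμ
  have hH : μ.IsAddHaarMeasure := φ.isAddHaarMeasure_map volume
  set c := μ.addHaarScalarFactor volume
  have hμc : μ = c • volume := Measure.isAddLeftInvariant_eq_smul μ volume
  have hme : MeasurableEmbedding φ := φ.toHomeomorph.measurableEmbedding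
  refine ⟨c, ?_, fun f => ?_, fun f hf => ?_⟩
  · exact_mod_cast Measure.addHaarScalarFactor_pos_of_isAddHaarMeasure μ volume
  · have h1 : ∫ v, f (φ v) = ∫ x, f x ∂μ := (hme.integral_map f).symm
    rw [hμc, integral_smul_nnreal_measure] at h1
    exact h1
  · have h1 : Integrable f μ := by
      rw [hμc]
      exact hf.smul_measure_nnreal
    exact hme.integrable_map_iff.mp h1

/-- Theta inversion: Poisson summation for Gaussians on the lattice spanned by a basis, up to the
covolume, whose inverse is the constant `c`. -/
theorem exists_theta_inversion [FiniteDimensional ℝ E] (b b' : Module.Basis ι ℝ E)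
    (hbb' : ∀ m v : ι → ℝ, inner ℝ (b'.equivFun.symm m) (b.equivFun.symm v) = ∑ i, m i * v i) :
    ∃ c : ℝ, 0 < c ∧ ∀ s : ℂ, 0 < s.re →
      ∑' k : ι → ℤ, Complex.exp (-(Real.pi * s * (‖b.equivFun.symm fun i => (k i : ℝ)‖ : ℂ) ^ 2)) =
        c * s⁻¹ ^ (Module.finrank ℝ E / 2 : ℂ) * ∑' m : ι → ℤ,
          Complex.exp (-(Real.pi * s⁻¹ * (‖b'.equivFun.symm fun i => (m i : ℝ)‖ : ℂ) ^ 2)) := by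
  let : MeasurableSpace E := borel E
  have : BorelSpace E := ⟨rfl⟩
  obtain ⟨c, hc, hci, hcint⟩ := exists_integral_equivFun_symm b
  refine ⟨c, hc, fun s hs => ?_⟩
  have hπ := Real.pi_pos
  have hπs : 0 < (Real.pi * s).re := by rw [Complex.re_ofReal_mul]; positivity
  have hs0 : s ≠ 0 := by rintro rfl; simp at hs
  have hφ : Continuous b.equivFun.symm := b.equivFunL.symm.continuous
  set g : (ι → ℝ) → ℂ := fun v => Complex.exp (-(Real.pi * s * (‖b.equivFun.symm v‖ : ℂ) ^ 2))
    with hg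
  have hF : ∀ m : ι → ℤ,
      ∫ v, Complex.exp (-(2 * Real.pi * Complex.I * ∑ i, (m i * v i : ℝ))) * g v =
      c * s⁻¹ ^ (Module.finrank ℝ E / 2 : ℂ) *
        Complex.exp (-(Real.pi * s⁻¹ * (‖b'.equivFun.symm fun i => (m i : ℝ)‖ : ℂ) ^ 2)) := by
    intro m
    set w := b'.equivFun.symm fun i => (m i : ℝ)
    have h1 := GaussianFourier.integral_cexp_neg_mul_sq_norm_add hπs (-(2 * Real.pi * Complex.I)) w
    have h2 := hci fun x =>
      Complex.exp (-(Real.pi * s) * ‖x‖ ^ 2 + -(2 * Real.pi * Complex.I) * (inner ℝ w x : ℝ))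
    rw [h1] at h2
    have h3 : ∀ v, Complex.exp (-(2 * Real.pi * Complex.I * ∑ i, (m i * v i : ℝ))) * g v =
        Complex.exp (-(Real.pi * s) * (‖b.equivFun.symm v‖ : ℂ) ^ 2
          + -(2 * Real.pi * Complex.I) * (inner ℝ w (b.equivFun.symm v) : ℝ)) := fun v => by
      rw [hg, hbb', ← Complex.exp_add]
      congr 1
      push_cast
      ring
    simp only [h3, h2]
    have hπ0 : (Real.pi : ℂ) ≠ 0 := by exact_mod_cast hπ.ne'
    have h4 : (Real.pi : ℂ) / (Real.pi * s) = s⁻¹ := by field_simp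
    have h5 : (-(2 * Real.pi * Complex.I)) ^ 2 * (‖w‖ : ℂ) ^ 2 / (4 * (Real.pi * s)) =
        -(Real.pi * s⁻¹ * (‖w‖ : ℂ) ^ 2) := by
      have := Complex.I_sq
      field_simp
      linear_combination 4 * (‖w‖ : ℂ) ^ 2 * this
    rw [h4, h5]
    ring
  have hsre : 0 < (s⁻¹).re := by
    rw [Complex.inv_re]
    exact div_pos hs (Complex.normSq_pos.mpr hs0)
  have key := tsum_eq_tsum_fourier_pi (g := g) (by fun_prop) ?_ ?_ ?_
  · simp only [hF, tsum_mul_left] at key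
    exact key
  · refine hcint (fun x => Complex.exp (-(Real.pi * s * (‖x‖ : ℂ) ^ 2))) ?_
    have := GaussianFourier.integrable_cexp_neg_mul_sq_norm_add hπs 0 (0 : E)
    simpa [neg_mul] using this
  · intro R
    set K := ‖(b.equivFunL.symm : (ι → ℝ) →L[ℝ] E)‖ with hK
    refine ⟨fun k => Real.exp (Real.pi * s.re * (K * R) ^ 2) *
      Real.exp (-(Real.pi * s.re / 2 * ‖b.equivFun.symm fun i => (k i : ℝ)‖ ^ 2)),
      (summable_exp_neg_mul_sq_norm_basis b (by positivity)).mul_left _, fun k v hv => ?_⟩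
    simp only [hg]
    rw [norm_cexp_neg_pi_mul_sq_norm, ← Real.exp_add, Real.exp_le_exp, map_add]
    set x := b.equivFun.symm v with hx
    set y := b.equivFun.symm fun i => (k i : ℝ)
    have h1 : ‖x‖ ≤ K * R :=
      ((b.equivFunL.symm : (ι → ℝ) →L[ℝ] E).le_opNorm v).trans (by gcongr)
    have h2 : ‖y‖ ≤ ‖x + y‖ + ‖x‖ := by
      have := norm_sub_le (x + y) x
      simpa using this
    have h3 : ‖x‖ ^ 2 ≤ (K * R) ^ 2 := by gcongr
    have h4 : ‖y‖ ^ 2 ≤ 2 * ‖x + y‖ ^ 2 + 2 * ‖x‖ ^ 2 := by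
      have : ‖y‖ ^ 2 ≤ (‖x + y‖ + ‖x‖) ^ 2 := by gcongr
      nlinarith [sq_nonneg (‖x + y‖ - ‖x‖)]
    have hps : 0 < Real.pi * s.re := by positivity
    nlinarith
  · simp only [hF]
    refine Summable.mul_left _ (Summable.of_norm ?_)
    simp only [norm_cexp_neg_pi_mul_sq_norm]
    exact summable_exp_neg_mul_sq_norm_basis b' (by positivity)

end GaussianPoisson

/-! ### Theta series of modular lattices -/

section ThetaSeries

variable {E : Type*} [NormedAddCommGroup E] [InnerProductSpace ℝ E]

/-- The theta series `∑ q ^ (⟪x, x⟫ / 2)` of a lattice, as a function on the upper half plane. -/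
noncomputable def latticeTheta (L : Submodule ℤ E) (τ : UpperHalfPlane) : ℂ :=
  ∑' x : L, Complex.exp (Real.pi * Complex.I * τ * (‖(x : E)‖ : ℂ) ^ 2)

lemma tsum_span_basis {ι : Type*} [Fintype ι] (b : Module.Basis ι ℝ E) {L : Submodule ℤ E}
    (hL : Submodule.span ℤ (Set.range b) = L) (f : E → ℂ) :
    ∑' x : L, f x = ∑' k : ι → ℤ, f (b.equivFun.symm fun i => (k i : ℝ)) := by
  subst hL
  rw [← (b.restrictScalars ℤ).equivFun.symm.toEquiv.tsum_eq]
  refine tsum_congr fun k => ?_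
  rw [← coe_restrictScalars_equivFun_symm]
  rfl

lemma exists_nat_evenNorm {L : Submodule ℤ E} (hL : IsEvenLattice L) (x : L) :
    ∃ n : ℕ, evenNorm (x : E) = n := by
  obtain ⟨n, hn⟩ := hL x x.2
  have h0 : 0 ≤ n := by
    have : (0 : ℝ) ≤ inner ℝ (x : E) x := real_inner_self_nonneg
    rw [hn] at this
    exact_mod_cast (by linarith : (0 : ℝ) ≤ n)
  lift n to ℕ using h0
  exact ⟨n, by rw [evenNorm, hn]; push_cast; ring⟩

/-- A similarity that maps the dual onto `L` turns a Gaussian sum over the dual into one over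
`L`. -/
lemma tsum_zDual_of_similarity {ℓ : ℕ} {L : Submodule ℤ E} {σ : E ≃ₗ[ℝ] E}
    (hσ : ∀ x y : E, inner ℝ (σ x) (σ y) = (ℓ : ℝ) * inner ℝ x y)
    (hL : σ '' (zDual L : Set E) = (L : Set E)) (z : ℂ) :
    ∑' y : zDual L, Complex.exp (ℓ * z * (‖(y : E)‖ : ℂ) ^ 2) =
      ∑' x : L, Complex.exp (z * (‖(x : E)‖ : ℂ) ^ 2) := by
  have hmem : ∀ y, y ∈ zDual L ↔ σ y ∈ L := fun y => by
    have h : σ y ∈ (L : Set E) ↔ y ∈ zDual L := by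
      rw [← hL]
      exact σ.injective.mem_set_image
    exact h.symm
  set e : zDual L ≃ L := σ.toEquiv.subtypeEquiv hmem
  rw [← e.tsum_eq]
  refine tsum_congr fun y => ?_
  have h1 : ‖((e y : L) : E)‖ ^ 2 = ℓ * ‖(y : E)‖ ^ 2 := by
    rw [← real_inner_self_eq_norm_sq, ← real_inner_self_eq_norm_sq, ← hσ]
    rfl
  have h2 : (‖((e y : L) : E)‖ : ℂ) ^ 2 = ℓ * (‖(y : E)‖ : ℂ) ^ 2 := by exact_mod_cast h1
  rw [h2]
  ring_nf

variable [FiniteDimensional ℝ E]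

/-- Theta inversion for a lattice and its dual, up to the covolume. -/
theorem exists_theta_inversion_zDual (L : Submodule ℤ E) [DiscreteTopology L] [IsZLattice ℝ L] :
    ∃ c : ℝ, 0 < c ∧ ∀ s : ℂ, 0 < s.re →
      ∑' x : L, Complex.exp (-(Real.pi * s * (‖(x : E)‖ : ℂ) ^ 2)) =
        c * s⁻¹ ^ (Module.finrank ℝ E / 2 : ℂ) *
          ∑' y : zDual L, Complex.exp (-(Real.pi * s⁻¹ * (‖(y : E)‖ : ℂ) ^ 2)) := by
  classical
  have : Module.Free ℤ L := ZLattice.module_free ℝ L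
  have : Module.Finite ℤ L := ZLattice.module_finite ℝ L
  set b := (Module.Free.chooseBasis ℤ L).ofZLatticeBasis ℝ L with hb
  have hL : Submodule.span ℤ (Set.range b) = L := Module.Basis.ofZLatticeBasis_span ℝ L _
  have hnd : (innerₗ E : LinearMap.BilinForm ℝ E).Nondegenerate := by
    refine ⟨fun x hx => ?_, fun x hx => ?_⟩ <;> exact inner_self_eq_zero.mp (hx x)
  set b' := LinearMap.BilinForm.dualBasis (innerₗ E) hnd b with hb'
  have hL' : Submodule.span ℤ (Set.range b') = zDual L := by
    rw [hb', ← LinearMap.BilinForm.dualSubmodule_span_of_basis, hL, zDual]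
  have hbb' : ∀ m v, inner ℝ (b'.equivFun.symm m) (b.equivFun.symm v) = ∑ i, m i * v i := by
    intro m v
    have h : ∀ i j, inner ℝ (b' i) (b j) = if j = i then (1 : ℝ) else 0 := fun i j =>
      LinearMap.BilinForm.apply_dualBasis_left (B := innerₗ E) hnd b i j
    simp [Module.Basis.equivFun_symm_apply, sum_inner, inner_sum, inner_smul_left,
      inner_smul_right, h, mul_comm]
  obtain ⟨c, hc, h⟩ := exists_theta_inversion b b' hbb'
  refine ⟨c, hc, fun s hs => ?_⟩
  rw [tsum_span_basis b hL fun x => Complex.exp (-(Real.pi * s * (‖x‖ : ℂ) ^ 2)),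
    tsum_span_basis b' hL' fun x => Complex.exp (-(Real.pi * s⁻¹ * (‖x‖ : ℂ) ^ 2)), h s hs]

lemma summable_latticeTheta (L : Submodule ℤ E) [DiscreteTopology L] (τ : UpperHalfPlane) :
    Summable fun x : L => Complex.exp (Real.pi * Complex.I * τ * (‖(x : E)‖ : ℂ) ^ 2) := by
  refine Summable.of_norm ?_
  refine (summable_exp_neg_mul_sq_norm L (c := Real.pi * τ.im)
    (mul_pos Real.pi_pos τ.im_pos)).congr fun x => ?_
  have h := norm_cexp_neg_pi_mul_sq_norm (-Complex.I * τ) (x : E)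
  have h1 : (-Complex.I * τ).re = τ.im := by simp
  rw [h1] at h
  rw [← h]
  congr 2
  ring

lemma latticeTheta_I_ne_zero (L : Submodule ℤ E) [DiscreteTopology L] :
    latticeTheta L UpperHalfPlane.I ≠ 0 := by
  have h : ∀ x : L, Complex.exp (Real.pi * Complex.I * UpperHalfPlane.I * (‖(x : E)‖ : ℂ) ^ 2) =
      (Real.exp (-(Real.pi * ‖(x : E)‖ ^ 2)) : ℂ) := fun x => by
    have := Complex.I_mul_I
    push_cast
    congr 1
    linear_combination (Real.pi * (‖(x : E)‖ : ℂ) ^ 2) * this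
  rw [latticeTheta, tsum_congr h, ← Complex.ofReal_tsum, Complex.ofReal_ne_zero]
  exact ((summable_exp_neg_mul_sq_norm L Real.pi_pos).tsum_pos (fun _ => (Real.exp_pos _).le) 0
    (Real.exp_pos _)).ne'

/-- The theta series of a `3`-modular lattice of rank `28` is an eigenfunction of the Fricke
involution. The covolume is forced to be `3 ^ 7` because the involution has order two. -/
theorem latticeTheta_fricke {L : Submodule ℤ E} [DiscreteTopology L] [IsZLattice ℝ L]
    (hr : Module.finrank ℤ L = 28) (hL : IsModularZLattice 3 L) (τ : UpperHalfPlane) :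
    latticeTheta L (fricke τ) = -3 ^ 7 * (τ : ℂ) ^ 14 * latticeTheta L τ := by
  obtain ⟨-, σ, hσ, hσL⟩ := hL
  obtain ⟨c, hc, h⟩ := exists_theta_inversion_zDual L
  have hdim : Module.finrank ℝ E = 28 := by rw [← ZLattice.rank ℝ L, hr]
  -- The factor `3 ^ 14` comes from `s⁻¹ ^ 14` with `s⁻¹ = -3 i τ`.
  set κ : ℝ := c * 3 ^ 14 with hκ
  have key : ∀ τ : UpperHalfPlane,
      latticeTheta L (fricke τ) = -κ * (τ : ℂ) ^ 14 * latticeTheta L τ := by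
    intro τ
    have hτ := τ.ne_zero
    have hI := Complex.I_ne_zero
    have hI2 := Complex.I_sq
    set s : ℂ := Complex.I / (3 * τ) with hs
    have hsinv : s⁻¹ = -(3 * Complex.I * τ) := by
      rw [hs, inv_div, div_eq_iff hI]
      linear_combination (3 * (τ : ℂ)) * hI2
    have hsre : 0 < s.re := by
      have h1 : s = -Complex.I * fricke τ := by
        rw [hs, coe_fricke]
        field_simp
      have h2 : s.re = (fricke τ).im := by rw [h1]; simp
      rw [h2]
      exact (fricke τ).im_pos
    have h1 := h s hsre
    have h2 : latticeTheta L (fricke τ) =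
        ∑' x : L, Complex.exp (-(Real.pi * s * (‖(x : E)‖ : ℂ) ^ 2)) := by
      refine tsum_congr fun x => ?_
      rw [coe_fricke, hs]
      congr 1
      field_simp
    have h3 : latticeTheta L τ =
        ∑' y : zDual L, Complex.exp (-(Real.pi * s⁻¹ * (‖(y : E)‖ : ℂ) ^ 2)) := by
      rw [latticeTheta, ← tsum_zDual_of_similarity hσ hσL]
      refine tsum_congr fun x => ?_
      rw [hsinv]
      push_cast
      ring_nf
    have h4 : s⁻¹ ^ (Module.finrank ℝ E / 2 : ℂ) = -3 ^ 14 * (τ : ℂ) ^ 14 := by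
      have : (Module.finrank ℝ E / 2 : ℂ) = ((14 : ℕ) : ℂ) := by rw [hdim]; norm_num
      rw [this, Complex.cpow_natCast, hsinv]
      have hI14 : Complex.I ^ 14 = -1 := by
        rw [show 14 = 2 * 7 from rfl, pow_mul, hI2]; norm_num
      rw [neg_pow, mul_pow, mul_pow, hI14]
      norm_num
    rw [h2, h1, ← h3, h4, hκ]
    push_cast
    ring
  have hκ7 : κ = 3 ^ 7 := by
    have h1 := key (fricke UpperHalfPlane.I)
    rw [fricke_fricke, key, coe_fricke] at h1
    have h0 := latticeTheta_I_ne_zero L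
    have hI14 : Complex.I ^ 14 = -1 := by
      rw [show 14 = 2 * 7 from rfl, pow_mul, Complex.I_sq]; norm_num
    have hI14' : (-1 / (3 * Complex.I)) ^ 14 = -1 / 3 ^ 14 := by
      rw [div_pow, mul_pow, hI14]; norm_num
    rw [UpperHalfPlane.coe_I, hI14, hI14'] at h1
    have h2 : (κ : ℂ) ^ 2 = 3 ^ 14 := by
      have h5 : latticeTheta L UpperHalfPlane.I * ((κ : ℂ) ^ 2 - 3 ^ 14) = 0 := by
        linear_combination -3 ^ 14 * h1
      have h6 := (mul_eq_zero.mp h5).resolve_left h0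
      linear_combination h6
    have h3 : κ ^ 2 = (3 ^ 7) ^ 2 := by
      have : κ ^ 2 = 3 ^ 14 := by exact_mod_cast h2
      rw [this]; norm_num
    exact (pow_left_inj₀ (by positivity) (by norm_num) two_ne_zero).mp h3
  rw [key, hκ7]
  push_cast
  ring

/-- The `q`-expansion of the theta series of an even lattice counts vectors by norm. -/
lemma hasSum_latticeTheta {L : Submodule ℤ E} [DiscreteTopology L] (hL : IsEvenLattice L)
    (τ : UpperHalfPlane) :
    HasSum (fun n : ℕ => ({x : E | x ∈ L ∧ evenNorm x = n}.ncard : ℂ) *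
      Function.Periodic.qParam 1 τ ^ n) (latticeTheta L τ) := by
  choose N hN using exists_nat_evenNorm hL
  have h := (summable_latticeTheta L τ).hasSum.tsum_fiberwise N
  refine (congrArg (HasSum · _) (funext fun n => ?_)).mpr h
  have hq : ∀ x : N ⁻¹' {n}, Complex.exp (Real.pi * Complex.I * τ * (‖((x : L) : E)‖ : ℂ) ^ 2) =
      Function.Periodic.qParam 1 τ ^ n := fun x => by
    have h1 : ‖((x : L) : E)‖ ^ 2 = 2 * n := by
      have h2 := hN x
      rw [show N x = n from x.2, evenNorm, real_inner_self_eq_norm_sq] at h2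
      linarith
    have h3 : (‖((x : L) : E)‖ : ℂ) ^ 2 = 2 * n := by exact_mod_cast h1
    rw [h3, Function.Periodic.qParam, ← Complex.exp_nat_mul]
    congr 1
    push_cast
    ring
  have hset : {x : E | x ∈ L ∧ evenNorm x = n} = Subtype.val '' (N ⁻¹' {n}) := by
    ext x
    simp only [Set.mem_ofPred_eq, Set.mem_image, Set.mem_preimage, Set.mem_singleton_iff]
    refine ⟨fun ⟨hx, hxn⟩ => ⟨⟨x, hx⟩, ?_, rfl⟩, ?_⟩
    · exact_mod_cast (hN ⟨x, hx⟩).symm.trans hxn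
    · rintro ⟨y, hy, rfl⟩
      exact ⟨y.2, by rw [hN, hy]⟩
  rw [tsum_congr hq, tsum_const, hset, Set.ncard_image_of_injective _ Subtype.val_injective,
    nsmul_eq_mul]
  rfl

theorem ncard_evenNorm_eq_three {L : Submodule ℤ E} [DiscreteTopology L] [IsZLattice ℝ L]
    (hr : Module.finrank ℤ L = 28) (hL : IsModularZLattice 3 L)
    (hmin : ∀ x ∈ L, x ≠ 0 → 2 ≤ evenNorm x) : {x : E | x ∈ L ∧ evenNorm x = 3}.ncard = 17472 := by
  have h := hasJet_of_hasSum (hasSum_latticeTheta hL.1)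
  have h0 : {x : E | x ∈ L ∧ evenNorm x = (0 : ℕ)} = {0} := by
    ext x
    simp only [Set.mem_ofPred_eq, Set.mem_singleton_iff]
    refine ⟨fun ⟨hx, hx0⟩ => ?_, fun hx => ?_⟩
    · by_contra hne
      have := hmin x hx hne
      rw [hx0] at this
      norm_num at this
    · subst hx
      simp [evenNorm]
  have h1 : {x : E | x ∈ L ∧ evenNorm x = (1 : ℕ)} = ∅ := by
    ext x
    simp only [Set.mem_ofPred_eq, Set.mem_empty_iff_false, iff_false, not_and]
    intro hx hx1
    have hne : x ≠ 0 := by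
      rintro rfl
      simp [evenNorm] at hx1
    have := hmin x hx hne
    rw [hx1] at this
    norm_num at this
  rw [h0, h1, Set.ncard_singleton, Set.ncard_empty, Nat.cast_one, Nat.cast_zero] at h
  exact_mod_cast coeff_three_of_fricke h (latticeTheta_fricke hr hL)

end ThetaSeries

/-! ### Eisenstein integers in the complex numbers -/

section EisensteinEmbedding

/-- The embedding `ℚ(√-3) → ℂ` with `√-3 ↦ √3 i`. -/
noncomputable def eisToComplex : QSqrtNegThree →ₐ[ℚ] ℂ :=
  QuadraticAlgebra.lift ⟨(√3 : ℝ) * Complex.I, by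
    have h : ((√3 : ℝ) : ℂ) ^ 2 = 3 := by exact_mod_cast Real.sq_sqrt (by norm_num : (0 : ℝ) ≤ 3)
    have hI := Complex.I_sq
    simp only [Algebra.smul_def, map_neg, map_ofNat, map_zero]
    linear_combination Complex.I ^ 2 * h + 3 * hI⟩

lemma eisToComplex_apply (z : QSqrtNegThree) :
    eisToComplex z = z.re + z.im * ((√3 : ℝ) * Complex.I) := by
  simp only [eisToComplex, QuadraticAlgebra.lift, Algebra.smul_def, Equiv.coe_fn_mk]
  simp
  rfl

lemma eisToComplex_re (z : QSqrtNegThree) : (eisToComplex z).re = z.re := by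
  simp [eisToComplex_apply]

lemma eisToComplex_im (z : QSqrtNegThree) : (eisToComplex z).im = z.im * √3 := by
  simp [eisToComplex_apply]

lemma eisToComplex_star (z : QSqrtNegThree) :
    eisToComplex (star z) = star (eisToComplex z) := by
  apply Complex.ext <;> simp [eisToComplex_re, eisToComplex_im]

lemma denseRange_eisToComplex : DenseRange eisToComplex := by
  have h3 : √3 ≠ 0 := by positivity
  have h1 : DenseRange (Prod.map (Rat.cast : ℚ → ℝ) (Rat.cast : ℚ → ℝ)) :=
    Rat.denseRange_cast.prodMap Rat.denseRange_cast
  set g : ℝ × ℝ → ℂ := fun p => p.1 + p.2 * ((√3 : ℝ) * Complex.I)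
  have hg : Function.Surjective g := fun z => ⟨(z.re, z.im / √3), by
    apply Complex.ext <;> simp [g, h3]⟩
  have h2 : DenseRange (g ∘ Prod.map (Rat.cast : ℚ → ℝ) (Rat.cast : ℚ → ℝ)) :=
    hg.denseRange.comp h1 (by fun_prop)
  refine h2.mono ?_
  rintro _ ⟨⟨p, q⟩, rfl⟩
  exact ⟨⟨p, q⟩, by simp [eisToComplex_apply, g]⟩

lemma mem_eisensteinInt_iff {z : QSqrtNegThree} :
    z ∈ EisensteinInt ↔ ∃ m k : ℤ, z = ⟨m - k / 2, k / 2⟩ := by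
  constructor
  · intro hz
    induction hz using Algebra.adjoin_induction with
    | mem x hx =>
      rw [Set.mem_singleton_iff] at hx
      exact ⟨0, 1, by rw [hx, eisOmega]; ext <;> norm_num⟩
    | algebraMap r => exact ⟨r, 0, by ext <;> simp⟩
    | add x y _ _ hx hy =>
      obtain ⟨m, k, rfl⟩ := hx
      obtain ⟨m', k', rfl⟩ := hy
      exact ⟨m + m', k + k', by ext <;> simp <;> ring⟩
    | mul x y _ _ hx hy =>
      obtain ⟨m, k, rfl⟩ := hx
      obtain ⟨m', k', rfl⟩ := hy
      exact ⟨m * m' - k * k', m * k' + k * m' - k * k', by ext <;> simp <;> ring⟩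
  · rintro ⟨m, k, rfl⟩
    have h : (⟨m - k / 2, k / 2⟩ : QSqrtNegThree) = algebraMap ℤ _ m + algebraMap ℤ _ k * eisOmega := by
      ext <;> simp [eisOmega] <;> ring
    rw [h]
    exact add_mem (algebraMap_mem _ _) (mul_mem (algebraMap_mem _ _)
      (Algebra.subset_adjoin (Set.mem_singleton _)))

/-- The element `√-3` of the ring of Eisenstein integers. -/
noncomputable def eisSqrt : QSqrtNegThree := ⟨0, 1⟩

lemma eisSqrt_mem : eisSqrt ∈ EisensteinInt :=
  mem_eisensteinInt_iff.mpr ⟨1, 2, by ext <;> norm_num [eisSqrt]⟩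

lemma eisOmega_mem : eisOmega ∈ EisensteinInt := Algebra.subset_adjoin (Set.mem_singleton _)

lemma eisToComplex_eisSqrt : eisToComplex eisSqrt = (√3 : ℝ) * Complex.I := by
  simp [eisToComplex_apply, eisSqrt]

/-- The trace dual of the Eisenstein integers is `(1 / √-3) ℤ[ω]`. -/
lemma exists_eisenstein_of_trace_dual {w : ℂ}
    (h : ∀ γ ∈ EisensteinInt, ∃ n : ℤ, 2 * (star (eisToComplex γ) * w).re = n) :
    ∃ δ ∈ EisensteinInt, eisToComplex δ = eisToComplex eisSqrt * w := by
  obtain ⟨n, hn⟩ := h 1 (one_mem _)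
  obtain ⟨p, hp⟩ := h eisOmega eisOmega_mem
  have h3 : √3 * √3 = 3 := Real.mul_self_sqrt (by norm_num)
  simp [Complex.mul_re, eisToComplex_re, eisToComplex_im, eisOmega] at hn hp
  refine ⟨⟨(-p : ℤ) - n / 2, n / 2⟩, mem_eisensteinInt_iff.mpr ⟨-p, n, rfl⟩, ?_⟩
  rw [eisToComplex_eisSqrt]
  apply Complex.ext
  · simp [eisToComplex_re]
    linarith
  · simp [eisToComplex_im]
    rw [← hn]
    ring

end EisensteinEmbedding

section TraceLattice

open Matrix

open scoped ComplexOrder MatrixOrder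

/-- A positive definite Hermitian matrix is the Gram matrix of a basis of a Euclidean space; the
inner product is normalised as the trace form. -/
lemma exists_linearEquiv_of_posDef {n : ℕ} {M : Matrix (Fin n) (Fin n) ℂ} (hM : M.PosSemidef)
    (hdet : M.det ≠ 0) : ∃ ψ : (Fin n → ℂ) ≃ₗ[ℂ] EuclideanSpace ℂ (Fin n),
      ∀ z w, inner ℝ (ψ z) (ψ w) = 2 * (star z ⬝ᵥ M *ᵥ w).re := by
  obtain ⟨B, rfl⟩ : ∃ B : Matrix (Fin n) (Fin n) ℂ, M = Bᴴ * B := by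
    exact CStarAlgebra.nonneg_iff_eq_star_mul_self.mp hM.nonneg
  have hB : IsUnit B := by
    rw [Matrix.isUnit_iff_isUnit_det, isUnit_iff_ne_zero]
    intro h
    rw [Matrix.det_mul, h, mul_zero] at hdet
    exact hdet rfl
  have h2 : ((√2 : ℝ) : ℂ) ≠ 0 := by exact_mod_cast (by positivity : √2 ≠ 0)
  set e : (Fin n → ℂ) ≃ₗ[ℂ] (Fin n → ℂ) :=
    LinearEquiv.ofBijective B.mulVecLin ⟨(Matrix.mulVec_injective_iff_isUnit).mpr hB,
      (Matrix.mulVec_surjective_iff_isUnit).mpr hB⟩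
  refine ⟨(e.trans (LinearEquiv.smulOfNeZero ℂ _ _ h2)).trans (WithLp.linearEquiv 2 ℂ _).symm,
    fun z w => ?_⟩
  have h22 : √2 * √2 = 2 := Real.mul_self_sqrt (by norm_num)
  have hin : ∀ x y : EuclideanSpace ℂ (Fin n), inner ℝ x y = (star x.ofLp ⬝ᵥ y.ofLp).re := by
    intro x y
    simp [PiLp.inner_apply, dotProduct, Complex.inner, mul_comm]
  rw [hin, ← Matrix.mulVec_mulVec, Matrix.dotProduct_mulVec, ← Matrix.star_mulVec]
  have : ∀ z, ((((e.trans (LinearEquiv.smulOfNeZero ℂ _ _ h2)).trans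
      (WithLp.linearEquiv 2 ℂ _).symm) z : EuclideanSpace ℂ (Fin n))).ofLp =
      ((√2 : ℝ) : ℂ) • B *ᵥ z := fun z => rfl
  rw [this, this, star_smul, smul_dotProduct, dotProduct_smul, smul_smul]
  simp only [RCLike.star_def, Complex.conj_ofReal, ← Complex.ofReal_mul, h22, smul_eq_mul]
  rw [Complex.re_ofReal_mul]

end TraceLattice

/-! ### The trace lattice of a unimodular Eisenstein lattice -/

section EisensteinTraceLattice

open Matrix

open scoped ComplexOrder

variable {V : Type*} [AddCommGroup V] [Module QSqrtNegThree V]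
  {h : V →ₗ[QSqrtNegThree] V →ₗ⋆[QSqrtNegThree] QSqrtNegThree}

/-- The complex Gram matrix of a finite family of vectors of a Hermitian space, in the convention
in which the form is conjugate linear in the first variable. -/
noncomputable def complexGram (h : V →ₗ[QSqrtNegThree] V →ₗ⋆[QSqrtNegThree] QSqrtNegThree) {n : ℕ}
    (v : Fin n → V) : Matrix (Fin n) (Fin n) ℂ :=
  Matrix.of fun i j => eisToComplex (h (v j) (v i))

lemma dotProduct_complexGram {n : ℕ} (v : Fin n → V) (c d : Fin n → QSqrtNegThree) :
    star (fun i => eisToComplex (c i)) ⬝ᵥ complexGram h v *ᵥ (fun i => eisToComplex (d i)) =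
      eisToComplex (h (∑ i, d i • v i) (∑ i, c i • v i)) := by
  simp only [dotProduct, mulVec, complexGram, Matrix.of_apply, Pi.star_apply, map_sum,
    LinearMap.sum_apply, map_smul, LinearMap.smul_apply, LinearMap.map_smulₛₗ, smul_eq_mul,
    map_mul, starRingEnd_apply, eisToComplex_star, Finset.mul_sum]
  refine Finset.sum_congr rfl fun i _ => Finset.sum_congr rfl fun j _ => ?_
  ring

lemma IsHermitianProduct.im_self (hh : IsHermitianProduct h) (x : V) : (h x x).im = 0 := by
  have := congrArg QuadraticAlgebra.im (hh.conj_symm x x)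
  simp at this
  linarith

lemma IsHermitianProduct.re_self_nonneg (hh : IsHermitianProduct h) (x : V) :
    0 ≤ (h x x).re := by
  rcases eq_or_ne x 0 with rfl | hx
  · simp
  · exact (hh.pos x hx).le

/-- The complex Gram matrix is positive semidefinite: the form is nonnegative on vectors with
coordinates in `ℚ(√-3)`, which are dense. -/
lemma posSemidef_complexGram (hh : IsHermitianProduct h) {n : ℕ} (v : Fin n → V) :
    (complexGram h v).PosSemidef := by
  refine .of_dotProduct_mulVec_nonneg ?_ fun z => ?_
  · ext i j
    simp only [conjTranspose_apply, complexGram, Matrix.of_apply]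
    rw [← eisToComplex_star, hh.conj_symm]
  · have hd : DenseRange (Pi.map fun (_ : Fin n) => (eisToComplex : QSqrtNegThree → ℂ)) :=
      DenseRange.piMap fun _ => denseRange_eisToComplex
    refine hd.induction_on (p := fun z => 0 ≤ star z ⬝ᵥ complexGram h v *ᵥ z) z ?_ fun c => ?_
    · exact isClosed_le continuous_const (by fun_prop)
    · have := dotProduct_complexGram (h := h) v c c
      change 0 ≤ star (fun i => eisToComplex (c i)) ⬝ᵥ
        complexGram h v *ᵥ (fun i => eisToComplex (c i))
      rw [this, Complex.nonneg_iff, eisToComplex_re, eisToComplex_im, hh.im_self]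
      refine ⟨?_, by simp⟩
      exact_mod_cast hh.re_self_nonneg _

lemma det_complexGram {n : ℕ} (v : Fin n → V) (hv : (Matrix.of fun i j => h (v i) (v j)).det = 1) :
    (complexGram h v).det = 1 := by
  have : complexGram h v =
      ((Matrix.of fun i j => h (v i) (v j)).map eisToComplex)ᵀ := by
    ext i j
    simp [complexGram]
  rw [this, det_transpose, ← AlgHom.mapMatrix_apply, ← AlgHom.map_det, hv, map_one]

lemma IsEisensteinLattice.exists_nat_self {L : Submodule EisensteinInt V}
    (hL : IsEisensteinLattice h L) (hh : IsHermitianProduct h) {x : V} (hx : x ∈ L) :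
    ∃ m : ℕ, h x x = m := by
  obtain ⟨m, k, hmk⟩ := mem_eisensteinInt_iff.mp (hL.integral x hx x hx)
  have him := hh.im_self x
  have hre := hh.re_self_nonneg x
  rw [hmk] at him hre
  have hk : (k : ℚ) = 0 := by simpa using him
  have hm : 0 ≤ m := by
    simp only [hk, zero_div, sub_zero] at hre
    exact_mod_cast hre
  lift m to ℕ using hm
  exact ⟨m, by rw [hmk, hk]; ext <;> simp⟩

lemma inner_mul_I_sqrt_three {n : ℕ} (x y : EuclideanSpace ℂ (Fin n)) :
    inner ℝ (eisToComplex eisSqrt • x) (eisToComplex eisSqrt • y) = 3 * inner ℝ x y := by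
  have h3 : ((√3 : ℝ) : ℂ) * (√3 : ℝ) = 3 := by
    exact_mod_cast Real.mul_self_sqrt (by norm_num : (0 : ℝ) ≤ 3)
  simp only [PiLp.inner_apply, PiLp.smul_apply, Complex.inner, Finset.mul_sum, smul_eq_mul]
  refine Finset.sum_congr rfl fun i _ => ?_
  have : eisToComplex eisSqrt * y i * (starRingEnd ℂ) (eisToComplex eisSqrt * x i) =
      ((3 : ℝ) : ℂ) * (y i * (starRingEnd ℂ) (x i)) := by
    rw [eisToComplex_eisSqrt]
    simp only [map_mul, Complex.conj_ofReal, Complex.conj_I]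
    have hI := Complex.I_sq
    push_cast
    linear_combination (starRingEnd ℂ) (x i) * y i * (-Complex.I ^ 2 * h3 - 3 * hI)
  rw [this, Complex.re_ofReal_mul]

/-- The trace form turns a unimodular Eisenstein lattice into a `3`-modular `ℤ`-lattice; the
similarity is multiplication by `√-3`. -/
theorem exists_trace_lattice {L : Submodule EisensteinInt V} (hh : IsHermitianProduct h)
    (hL : IsEisensteinLattice h L) {n : ℕ} (b : Module.Basis (Fin n) EisensteinInt L)
    (hb : (Matrix.of fun i j : Fin n => h (b i : V) (b j : V)).det = 1) :
    ∃ Θ : L →ₗ[ℤ] EuclideanSpace ℂ (Fin n),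
      (∀ x y : L, inner ℝ (Θ x) (Θ y) = 2 * (eisToComplex (h (y : V) (x : V))).re) ∧
      Submodule.span ℝ (Set.range Θ) = ⊤ ∧ IsModularZLattice 3 (LinearMap.range Θ) := by
  set v : Fin n → V := fun i => b i with hv
  set M := complexGram h v with hM
  have hdet : M.det = 1 := det_complexGram v hb
  obtain ⟨ψ, hψ⟩ := exists_linearEquiv_of_posDef (posSemidef_complexGram hh v)
    (by rw [← hM, hdet]; exact one_ne_zero)
  set κ : L → Fin n → ℂ := fun x i => eisToComplex (b.repr x i) with hκ
  have hsum : ∀ x : L, ∑ i, ((b.repr x i : EisensteinInt) : QSqrtNegThree) • v i = x := fun x => by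
    have := congrArg (Subtype.val : L → V) (b.sum_repr x)
    rw [Submodule.coe_sum] at this
    exact this
  let Θ : L →ₗ[ℤ] EuclideanSpace ℂ (Fin n) := AddMonoidHom.toIntLinearMap
    { toFun := fun x => ψ (κ x)
      map_zero' := by
        rw [← map_zero ψ]
        congr 1
        ext i
        simp [hκ]
      map_add' := fun x y => by
        rw [← map_add ψ]
        congr 1
        ext i
        simp [hκ] }
  have hΘ : ∀ x, Θ x = ψ (κ x) := fun x => rfl
  have hinner : ∀ x y : L, inner ℝ (Θ x) (Θ y) = 2 * (eisToComplex (h (y : V) (x : V))).re := by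
    intro x y
    rw [hΘ, hΘ, hψ]
    have := dotProduct_complexGram (h := h) v (fun i => b.repr x i) (fun i => b.repr y i)
    rw [hsum, hsum] at this
    rw [← this]
  have hκsmul : ∀ (γ : EisensteinInt) (x : L), κ (γ • x) = eisToComplex γ • κ x := fun γ x => by
    ext i
    simp [hκ]
  have hκb : ∀ i, κ (b i) = Pi.single i 1 := fun i => by
    ext j
    by_cases hij : i = j
    · subst hij; simp [hκ]
    · simp [hκ, Ne.symm hij]
  -- Every family of Eisenstein integers is the family of coordinates of a lattice vector.
  have hκsurj : ∀ z : Fin n → ℂ, (∀ i, ∃ δ ∈ EisensteinInt, eisToComplex δ = z i) →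
      ∃ x, κ x = z := fun z hz => by
    choose δ hδ hδz using hz
    refine ⟨∑ i, (⟨δ i, hδ i⟩ : EisensteinInt) • b i, ?_⟩
    ext j
    simp [hκ, ← hδz, Finsupp.single_apply]
  have hspan : Submodule.span ℝ (Set.range Θ) = ⊤ := by
    rw [eq_top_iff]
    rintro y -
    obtain ⟨z, rfl⟩ := ψ.surjective y
    have h3 : √3 ≠ 0 := by positivity
    have hz : z = ∑ i, ((z i).re • κ (b i) +
        ((z i).im / √3) • κ ((⟨eisSqrt, eisSqrt_mem⟩ : EisensteinInt) • b i)) := by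
      ext j
      simp only [hκsmul, hκb, Finset.sum_apply, Pi.add_apply, Pi.smul_apply, Pi.single_apply,
        smul_ite, smul_zero, eisToComplex_eisSqrt]
      rw [Finset.sum_add_distrib]
      simp only [Finset.sum_ite_eq, Finset.mem_univ, if_true]
      apply Complex.ext <;> simp [h3]
    have hψr : ∀ (r : ℝ) (w : Fin n → ℂ), ψ (r • w) = r • ψ w := fun r w =>
      (ψ.toLinearMap.restrictScalars ℝ).map_smul r w
    rw [hz, map_sum]
    refine sum_mem fun i _ => ?_
    rw [map_add, hψr, hψr]
    exact add_mem (Submodule.smul_mem _ _ (Submodule.subset_span ⟨_, rfl⟩))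
      (Submodule.smul_mem _ _ (Submodule.subset_span ⟨_, rfl⟩))
  refine ⟨Θ, hinner, hspan, ?_, ?_⟩
  · rintro _ ⟨x, rfl⟩
    obtain ⟨m, hm⟩ := hL.exists_nat_self hh x.2
    exact ⟨m, by rw [hinner, hm]; simp⟩
  have hθ0 : eisToComplex eisSqrt ≠ 0 := by
    rw [eisToComplex_eisSqrt]
    simp
  refine ⟨(LinearEquiv.smulOfNeZero ℂ _ _ hθ0).restrictScalars ℝ,
    fun x y => inner_mul_I_sqrt_three x y, ?_⟩
  have hΘsqrt : ∀ x : L, Θ ((⟨eisSqrt, eisSqrt_mem⟩ : EisensteinInt) • x) =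
      eisToComplex eisSqrt • Θ x := fun x => by
    rw [hΘ, hκsmul, map_smul, hΘ]
  have hdual : ∀ y, y ∈ zDual (LinearMap.range Θ) ↔
      ∀ x : L, ∃ m : ℤ, inner ℝ (Θ x) y = m := fun y => by
    rw [zDual, LinearMap.BilinForm.mem_dualSubmodule]
    constructor
    · intro hy x
      obtain ⟨m, hm⟩ := Submodule.mem_one.mp (hy _ ⟨x, rfl⟩)
      refine ⟨m, ?_⟩
      rw [real_inner_comm]
      simpa using hm.symm
    · rintro hy _ ⟨x, rfl⟩
      obtain ⟨m, hm⟩ := hy x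
      refine Submodule.mem_one.mpr ⟨m, ?_⟩
      rw [real_inner_comm] at hm
      simpa using hm.symm
  have hiff : ∀ y, y ∈ zDual (LinearMap.range Θ) ↔
      eisToComplex eisSqrt • y ∈ LinearMap.range Θ := fun y => by
    rw [hdual]
    constructor
    · intro hy
      obtain ⟨z, rfl⟩ := ψ.surjective y
      -- Pairing with multiples of the basis vectors shows that `√-3 M z` has Eisenstein coordinates;
      -- as `M` has determinant one, so has `√-3 z`.
      have hw : ∀ i, ∃ δ ∈ EisensteinInt, eisToComplex δ = eisToComplex eisSqrt * (M *ᵥ z) i := by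
        intro i
        refine exists_eisenstein_of_trace_dual fun γ hγ => ?_
        obtain ⟨m, hm⟩ := hy ((⟨γ, hγ⟩ : EisensteinInt) • b i)
        refine ⟨m, ?_⟩
        rw [← hm, hΘ, hψ, hκsmul, hκb, star_smul, smul_dotProduct]
        simp [hM]
      choose δ hδ hδw using hw
      have hz : eisToComplex eisSqrt • z = M.adjugate *ᵥ fun i => eisToComplex (δ i) := by
        have : (fun i => eisToComplex (δ i)) = eisToComplex eisSqrt • M *ᵥ z := funext hδw
        rw [this, mulVec_smul, mulVec_mulVec, adjugate_mul, hdet, one_smul, one_mulVec]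
      obtain ⟨x, hx⟩ := hκsurj (eisToComplex eisSqrt • z) fun i => by
        rw [hz]
        -- The adjugate of `M` has Eisenstein entries because `M` has.
        let f : EisensteinInt →+* ℂ :=
          (eisToComplex : QSqrtNegThree →+* ℂ).comp EisensteinInt.subtype
        let N : Matrix (Fin n) (Fin n) EisensteinInt :=
          Matrix.of fun i j => ⟨h (v j) (v i), hL.integral _ (b j).2 _ (b i).2⟩
        have hMN : M.adjugate = N.adjugate.map f := (f.map_adjugate N).symm
        refine ⟨_, ((N.adjugate *ᵥ fun i => (⟨δ i, hδ i⟩ : EisensteinInt)) i).2, ?_⟩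
        rw [hMN]
        exact f.map_mulVec N.adjugate _ i
      exact ⟨x, by rw [hΘ, hx, map_smul]⟩
    · rintro ⟨x₀, hx₀⟩ x
      have h1 : 3 * inner ℝ (Θ x) y =
          2 * (eisToComplex (h (x₀ : V) ((eisSqrt • (x : V))))).re := by
        rw [← inner_mul_I_sqrt_three, ← hΘsqrt, ← hx₀, hinner]
        rfl
      obtain ⟨m, k, hmk⟩ := mem_eisensteinInt_iff.mp (hL.integral x₀ x₀.2 x x.2)
      refine ⟨k, ?_⟩
      rw [LinearMap.map_smulₛₗ, hmk, eisToComplex_re] at h1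
      simp [eisSqrt, starRingEnd_apply] at h1
      linarith
  ext y
  constructor
  · rintro ⟨x, hx, rfl⟩
    exact (hiff x).mp hx
  · intro hy
    refine ⟨(eisToComplex eisSqrt)⁻¹ • y, ?_, ?_⟩
    · refine (hiff _).mpr ?_
      rwa [smul_inv_smul₀ hθ0]
    · exact smul_inv_smul₀ hθ0 y

end EisensteinTraceLattice

/-! ### Counting vectors of norm three -/

section Indecomposable

variable {V : Type*} [AddCommGroup V] [Module QSqrtNegThree V]
  {h : V →ₗ[QSqrtNegThree] V →ₗ⋆[QSqrtNegThree] QSqrtNegThree}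

/-- A vector of norm one splits off, so an indecomposable lattice of rank greater than one has
none. -/
lemma self_ne_one_of_indecomposable {L : Submodule EisensteinInt V} (hh : IsHermitianProduct h)
    (hL : IsEisensteinLattice h L)
    (hI : IsIndecomposableEisenstein h L) (hr : 1 < Module.finrank EisensteinInt L) {x : V}
    (hx : x ∈ L) : h x x ≠ 1 := by
  intro hx1
  have hsmul : ∀ (γ : EisensteinInt) (u w : V), h (γ • u) w = γ * h u w := fun γ u w => by
    rw [Subalgebra.smul_def, map_smul, LinearMap.smul_apply, smul_eq_mul]
  let N : Submodule EisensteinInt V :=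
    { carrier := {y | y ∈ L ∧ h y x = 0}
      add_mem' := fun {a b} ha hb => ⟨add_mem ha.1 hb.1, by
        rw [map_add, LinearMap.add_apply, ha.2, hb.2, add_zero]⟩
      zero_mem' := ⟨zero_mem _, by simp⟩
      smul_mem' := fun γ a ha => ⟨L.smul_mem γ ha.1, by rw [hsmul, ha.2, mul_zero]⟩ }
  have hM : Submodule.span EisensteinInt {x} ≤ L := by simpa using hx
  have hsup : Submodule.span EisensteinInt {x} ⊔ N = L := by
    refine le_antisymm (sup_le hM fun y hy => hy.1) fun y hy => ?_
    set γ : EisensteinInt := ⟨h y x, hL.integral y hy x hx⟩ with hγ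
    have h1 : γ • x ∈ Submodule.span EisensteinInt {x} :=
      Submodule.smul_mem _ _ (Submodule.mem_span_singleton_self x)
    refine Submodule.mem_sup.mpr ⟨γ • x, h1, y - γ • x, ⟨sub_mem hy (hM h1), ?_⟩, by abel⟩
    rw [map_sub, LinearMap.sub_apply, hsmul, hx1, mul_one, hγ, sub_self]
  have horth : ∀ u ∈ Submodule.span EisensteinInt {x}, ∀ w ∈ N, h u w = 0 := by
    intro u hu w hw
    obtain ⟨γ, rfl⟩ := Submodule.mem_span_singleton.mp hu
    rw [hsmul, ← hh.conj_symm, hw.2, star_zero, mul_zero]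
  rcases hI.2 _ _ hsup horth with hbot | hbot
  · rw [Submodule.span_singleton_eq_bot] at hbot
    rw [hbot] at hx1
    simp at hx1
  · rw [hbot, sup_bot_eq] at hsup
    rw [← hsup] at hr
    have := finrank_span_le_card (R := EisensteinInt) ({x} : Set V)
    rw [Set.toFinset_singleton, Finset.card_singleton] at this
    omega

/-- The trace lattice has rank `28` and is `3`-modular, and the trace form halved is the norm of the
Hermitian lattice, so the count for `ℤ`-lattices applies. -/
theorem ncard_self_eq_three {L : Submodule EisensteinInt V} (hh : IsHermitianProduct h)
    (hL : IsEisensteinLattice h L) (hr : Module.finrank EisensteinInt L = 14)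
    (hU : IsUnimodularEisenstein h L) (hI : IsIndecomposableEisenstein h L) :
    {x : V | x ∈ L ∧ h x x = 3}.ncard = 17472 := by
  obtain ⟨n, b, hb⟩ := hU
  obtain rfl : n = 14 := by
    rw [← hr, Module.finrank_eq_card_basis b, Fintype.card_fin]
  obtain ⟨Θ, hΘ, hspan, hmod⟩ := exists_trace_lattice hh hL b hb
  have hnorm : ∀ x : L, evenNorm (Θ x) = ((h (x : V) x).re : ℝ) := fun x => by
    rw [evenNorm, hΘ, eisToComplex_re]
    ring
  have hmin : ∀ x : L, x ≠ 0 → 2 ≤ evenNorm (Θ x) := fun x hx => by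
    have hx0 : (x : V) ≠ 0 := by simpa using hx
    obtain ⟨m, hm⟩ := hL.exists_nat_self hh x.2
    have hpos := hh.pos x hx0
    have hne := self_ne_one_of_indecomposable hh hL hI (by rw [hr]; norm_num) x.2
    rw [hm] at hpos hne
    have h0 : 0 < m := by simpa using hpos
    have h1 : m ≠ 1 := by rintro rfl; simp at hne
    rw [hnorm, hm]
    have : 2 ≤ m := by omega
    simp only [QuadraticAlgebra.re_natCast, Rat.cast_natCast]
    exact_mod_cast this
  have hinj : Function.Injective Θ := by
    rw [injective_iff_map_eq_zero]
    intro x hx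
    by_contra hne
    have := hmin x hne
    rw [hx] at this
    norm_num [evenNorm] at this
  have hmin' : ∀ y ∈ LinearMap.range Θ, y ≠ 0 → 2 ≤ evenNorm y := by
    rintro _ ⟨x, rfl⟩ hne
    exact hmin x fun h0 => hne (by rw [h0, map_zero])
  have hdisc : DiscreteTopology (LinearMap.range Θ) := by
    refine discreteTopology_of_isOpen_singleton_zero ?_
    rw [Metric.isOpen_singleton_iff]
    refine ⟨1, one_pos, fun y hy => ?_⟩
    by_contra hne
    have h2 := hmin' y y.2 (by simpa using hne)
    rw [evenNorm, real_inner_self_eq_norm_sq] at h2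
    rw [dist_zero_right, Submodule.coe_norm] at hy
    nlinarith [norm_nonneg (y : EuclideanSpace ℂ (Fin 14))]
  have hlat : IsZLattice ℝ (LinearMap.range Θ) := ⟨by rw [LinearMap.coe_range]; exact hspan⟩
  have hrank : Module.finrank ℤ (LinearMap.range Θ) = 28 := by
    rw [ZLattice.rank ℝ, finrank_real_of_complex, finrank_euclideanSpace_fin]
  have hcount := ncard_evenNorm_eq_three hrank hmod hmin'
  have h1 : {y | y ∈ LinearMap.range Θ ∧ evenNorm y = 3} = Θ '' {x : L | h (x : V) x = 3} := by
    have h3 : ∀ x : L, evenNorm (Θ x) = 3 ↔ h (x : V) x = 3 := fun x => by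
      rw [hnorm, QuadraticAlgebra.ext_iff, hh.im_self]
      simp only [QuadraticAlgebra.re_ofNat, QuadraticAlgebra.im_ofNat, and_true]
      norm_cast
    ext y
    constructor
    · rintro ⟨⟨x, rfl⟩, hx⟩
      exact ⟨x, (h3 x).mp hx, rfl⟩
    · rintro ⟨x, hx, rfl⟩
      exact ⟨⟨x, rfl⟩, (h3 x).mpr hx⟩
  have h2 : {x : V | x ∈ L ∧ h x x = 3} = Subtype.val '' {x : L | h (x : V) x = 3} := by
    ext x
    constructor
    · rintro ⟨hx, hx3⟩
      exact ⟨⟨x, hx⟩, hx3, rfl⟩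
    · rintro ⟨y, hy, rfl⟩
      exact ⟨y.2, hy⟩
  rw [h1, Set.ncard_image_of_injective _ hinj] at hcount
  rw [h2, Set.ncard_image_of_injective _ Subtype.val_injective, hcount]

end Indecomposable

theorem proposition1 :
    (∀ (E : Type*) [NormedAddCommGroup E] [InnerProductSpace ℝ E] [FiniteDimensional ℝ E]
        (L : Submodule ℤ E) [DiscreteTopology L] [IsZLattice ℝ L],
        Module.finrank ℤ L = 28 →
        IsModularZLattice 3 L →
        (∀ x ∈ L, x ≠ 0 → 2 ≤ evenNorm x) →
        {x : E | x ∈ L ∧ evenNorm x = 3}.ncard = 17472) ∧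
    (∀ (V : Type*) [AddCommGroup V] [Module QSqrtNegThree V]
        (h : V →ₗ[QSqrtNegThree] V →ₗ⋆[QSqrtNegThree] QSqrtNegThree)
        (L : Submodule EisensteinInt V),
        IsHermitianProduct h →
        IsEisensteinLattice h L →
        Module.finrank EisensteinInt L = 14 →
        IsUnimodularEisenstein h L →
        IsIndecomposableEisenstein h L →
        {x : V | x ∈ L ∧ h x x = 3}.ncard = 17472) :=
  ⟨fun _ _ _ _ _ _ _ hr hL hmin => ncard_evenNorm_eq_three hr hL hmin,
    fun _ _ _ _ _ hh hL hr hU hI => ncard_self_eq_three hh hL hr hU hI⟩
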